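/- All graphs are finite and have no loops. A plane graph $G$ has as vertices finitely many points of $\mathbb{R}^2$ and as edges simple arcs, each joining two distinct vertices; an edge contains no vertex other than its two ends, and two different edges meet only in common end vertices. Its faces are the connected components of the complement in $\mathbb{R}^2$ of the union of its vertices and edges; a vertex is incident with a face if it lies on the boundary of that face. The degree of a face is the number of vertices incident with it, and $\Delta^*(G)$ denotes the maximum face degree of $G$. A cyclic coloring of $G$ is a coloring of its vertices in which any two different vertices incident with the same face receive different colors; $\chi_c(G)$ is the minimum number of colors in a cyclic coloring of $G$. Let $t(G)$ be the number of vertices of a longest path in $G$ all of whose vertices have degree $2$ in $G$ ($t(G)=0$ if there is no vertex of degree $2$). Subdividing an edge $uv$ of a plane graph means placing a new vertex $w$ in the interior of that arc, so that the edge is replaced by a path $u,w,v$; a subdivision of a plane graph $R$ is a plane graph obtained from $R$ by a finite, possibly empty, sequence of subdivisions of edges. A graph is $3$-connected if it has at least four vertices and remains connected after the removal of any at most two vertices. **Corollary.** Let $R$ be a simple $3$-connected plane graph and let $G$ be a subdivision of $R$. If $$\Delta^*(G) \ge 2\chi_c(R) + 2t(G) - 6,$$ then $$\chi_c(G) \le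 \left\lfloor \tfrac{3}{2}\Delta^*(G) \right\rfloor .$$ -/

import Mathlib

/-- The Euclidean plane. -/
abbrev Plane : Type := EuclideanSpace ℝ (Fin 2)

/-- `A` is a simple arc in the plane with end points `x` and `y` (so `x ≠ y`). -/
def IsArc (x y : Plane) (A : Set Plane) : Prop :=
  ∃ γ : unitInterval → Plane,
    Continuous γ ∧ Function.Injective γ ∧ γ 0 = x ∧ γ 1 = y ∧ Set.range γ = A

/-- A finite plane graph without loops; multiple edges are allowed. The vertices are points of
the plane and every edge is a simple arc joining two vertices. An edge contains no vertices
besides its two ends, and two different edges meet only in vertices. -/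
structure PlaneGraph where
  verts : Set Plane
  edges : Set (Set Plane)
  finite_verts : verts.Finite
  finite_edges : edges.Finite
  isArc_of_mem : ∀ e ∈ edges, ∃ x ∈ verts, ∃ y ∈ verts, IsArc x y e ∧ e ∩ verts = {x, y}
  inter_subset : ∀ e ∈ edges, ∀ e' ∈ edges, e ≠ e' → e ∩ e' ⊆ verts

namespace PlaneGraph

/-- The set of points of the plane covered by the vertices and edges. -/
def support (G : PlaneGraph) : Set Plane := G.verts ∪ ⋃₀ G.edges

/-- The faces: the connected components of the complement of the drawing. -/
def faces (G : PlaneGraph) : Set (Set Plane) :=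
  {f | ∃ x ∈ G.supportᶜ, f = connectedComponentIn G.supportᶜ x}

/-- The set of vertices incident with a face `f`: those on the boundary of `f`. -/
def faceVerts (G : PlaneGraph) (f : Set Plane) : Set Plane := G.verts ∩ frontier f

/-- The degree of a face: the number of vertices incident with it. -/
noncomputable def faceDegree (G : PlaneGraph) (f : Set Plane) : ℕ := (G.faceVerts f).ncard

/-- The maximum face degree. -/
noncomputable def maxFaceDegree (G : PlaneGraph) : ℕ :=
  sSup {n : ℕ | ∃ f ∈ G.faces, G.faceDegree f = n}

/-- The degree of a vertex: the number of edges incident with it. -/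
noncomputable def degree (G : PlaneGraph) (v : Plane) : ℕ := {e ∈ G.edges | v ∈ e}.ncard

/-- The adjacency relation on the vertices. -/
def graph (G : PlaneGraph) : SimpleGraph G.verts where
  Adj u v := u ≠ v ∧ ∃ e ∈ G.edges, (u : Plane) ∈ e ∧ (v : Plane) ∈ e
  symm := ⟨fun _ _ ⟨h, e, he, hu, hv⟩ => ⟨h.symm, e, he, hv, hu⟩⟩
  loopless := ⟨fun _ h => h.1 rfl⟩

/-- A plane graph is simple if different edges have different pairs of ends. -/
def IsSimple (G : PlaneGraph) : Prop :=
  ∀ e ∈ G.edges, ∀ e' ∈ G.edges, e ∩ G.verts = e' ∩ G.verts → e = e'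

/-- A graph is 3-connected if it has at least four vertices and stays connected after the
removal of any set of at most two vertices. -/
def IsThreeConnected (G : PlaneGraph) : Prop :=
  4 ≤ G.verts.ncard ∧ ∀ S : Set G.verts, S.ncard ≤ 2 → (G.graph.induce Sᶜ).Connected

/-- A cyclic coloring: different vertices incident with a common face get different colors. -/
def IsCyclicColoring (G : PlaneGraph) {C : Type} (c : G.verts → C) : Prop :=
  ∀ f ∈ G.faces, ∀ u v : G.verts, (u : Plane) ∈ G.faceVerts f → (v : Plane) ∈ G.faceVerts f →
    u ≠ v → c u ≠ c v

/-- The cyclic chromatic number: the least number of colors in a cyclic coloring. -/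
noncomputable def cyclicChromaticNumber (G : PlaneGraph) : ℕ :=
  sInf {k : ℕ | ∃ c : G.verts → Fin k, G.IsCyclicColoring c}

/-- The number of vertices of a longest path all of whose vertices have degree two
(zero if there is no vertex of degree two). -/
noncomputable def longestTwoPath (G : PlaneGraph) : ℕ :=
  sSup {n : ℕ | ∃ (u v : G.verts) (p : G.graph.Walk u v),
    p.IsPath ∧ (∀ w ∈ p.support, G.degree w = 2) ∧ p.support.length = n}

/-- `G` arises from `R` by subdividing one edge `e`: a new vertex `w` is placed on `e`, which is
thereby replaced by its two subarcs, from one end `u` to `w` and from `w` to the other end `v`. -/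
def IsEdgeSubdivision (R G : PlaneGraph) : Prop :=
  ∃ e ∈ R.edges, ∃ u ∈ R.verts, ∃ v ∈ R.verts, ∃ w ∉ R.verts, ∃ e₁ e₂ : Set Plane,
    IsArc u w e₁ ∧ IsArc w v e₂ ∧ e₁ ∪ e₂ = e ∧ e₁ ∩ e₂ = {w} ∧
    G.verts = insert w R.verts ∧ G.edges = (R.edges \ {e}) ∪ {e₁, e₂}

/-- `G` is a subdivision of `R`: it arises by a finite (possibly empty) sequence of edge
subdivisions. -/
def IsSubdivision (R G : PlaneGraph) : Prop := Relation.ReflTransGen IsEdgeSubdivision R G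

end PlaneGraph

/-
Color the vertices of `R` cyclically with `χ_c(R)` colors, and the subdivision vertices with new
colors. Such a vertex `z` lies in the interior of an edge of `R` and is therefore incident with at
most two faces, so that `z` is an edge of a multigraph on the faces and a coloring of the
subdivision vertices is an edge coloring of that multigraph. A face has at least three vertices of
`R`, hence at most `Δ* - 3` subdivision vertices; two faces of a 3-connected plane graph share at
most one edge, and an edge contains at most `t` subdivision vertices. By Vizing's theorem for
multigraphs, `Δ* - 3 + t` new colors suffice, and the hypothesis says that
`χ_c(R) + Δ* - 3 + t ≤ 3 Δ* / 2`.

The facts on plane graphs do not go through the Jordan curve theorem: if a compact set `K`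
separates `a` from `b`, then `(z - a) / (z - b)` has no continuous logarithm on `K`, whereas
logarithms on `A` and on `B` can be glued to one on `A ∪ B` if `A ∩ B` is connected.
-/

open Set Filter Topology

/-! ### Continuous logarithms and separation in the plane -/

section HasLogOn

variable {X : Type*} [TopologicalSpace X]

theorem eq_of_exp_eq_const {S : Set X} (hS : IsPreconnected S) {g : X → ℂ}
    (hg : ContinuousOn g S) {c : ℂ} (hc : ∀ x ∈ S, Complex.exp (g x) = c) {x y : X} (hx : x ∈ S)
    (hy : y ∈ S) : g x = g y :=
  Complex.isCoveringMap_exp.constOn_of_comp hS hg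
    (fun a ha b hb => Subtype.ext ((hc a ha).trans (hc b hb).symm)) hx hy

theorem exists_continuous_log [SimplyConnectedSpace X] [LocallyPathConnectedSpace X] {f : X → ℂ}
    (hf : Continuous f) (h0 : ∀ x, f x ≠ 0) :
    ∃ g : X → ℂ, Continuous g ∧ ∀ x, Complex.exp (g x) = f x := by
  obtain ⟨x₀⟩ : Nonempty X := inferInstance
  obtain ⟨g, ⟨-, hg⟩, -⟩ := Complex.isCoveringMapOn_exp.existsUnique_continuousMap_lifts
    ⟨f, hf⟩ (Complex.exp_log (h0 x₀)) h0
  exact ⟨g, g.continuous, congrFun hg⟩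

/-- `f` has a continuous logarithm on `K`. This is how separation properties of plane sets are
detected here: whether `(z - a) / (z - b)` has a logarithm on a compact set `K` decides whether
`K` separates `a` from `b`. -/
def HasLogOn (f : X → ℂ) (K : Set X) : Prop :=
  ∃ g : X → ℂ, ContinuousOn g K ∧ ∀ z ∈ K, Complex.exp (g z) = f z

namespace HasLogOn

variable {f f' : X → ℂ} {A B K L : Set X}

theorem mono (h : HasLogOn f L) (hKL : K ⊆ L) : HasLogOn f K := by
  obtain ⟨g, hg, hgf⟩ := h
  exact ⟨g, hg.mono hKL, fun z hz => hgf z (hKL hz)⟩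

theorem congr (h : HasLogOn f K) (hf : EqOn f f' K) : HasLogOn f' K := by
  obtain ⟨g, hg, hgf⟩ := h
  exact ⟨g, hg, fun z hz => (hgf z hz).trans (hf hz)⟩

theorem mul (h : HasLogOn f K) (h' : HasLogOn f' K) : HasLogOn (fun z => f z * f' z) K := by
  obtain ⟨g, hg, hgf⟩ := h
  obtain ⟨g', hg', hgf'⟩ := h'
  exact ⟨fun z => g z + g' z, hg.add hg', fun z hz => by
    rw [Complex.exp_add, hgf z hz, hgf' z hz]⟩

theorem inv (h : HasLogOn f K) : HasLogOn (fun z => (f z)⁻¹) K := by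
  obtain ⟨g, hg, hgf⟩ := h
  exact ⟨fun z => -g z, hg.neg, fun z hz => by rw [Complex.exp_neg, hgf z hz]⟩

theorem of_finite [T1Space X] (hK : K.Finite) (h0 : ∀ z ∈ K, f z ≠ 0) : HasLogOn f K :=
  ⟨fun z => Complex.log (f z), hK.continuousOn _, fun z hz => Complex.exp_log (h0 z hz)⟩

theorem of_retract {Y : Type*} [TopologicalSpace Y] [SimplyConnectedSpace Y]
    [LocallyPathConnectedSpace Y] {p : Y → X} {s : X → Y} (hp : Continuous p)
    (hpK : ∀ y, p y ∈ K) (hs : ContinuousOn s K) (hps : ∀ z ∈ K, p (s z) = z)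
    (hf : ContinuousOn f K) (h0 : ∀ z ∈ K, f z ≠ 0) : HasLogOn f K := by
  obtain ⟨g, hg, hgf⟩ := exists_continuous_log (hf.comp_continuous hp hpK) fun y => h0 _ (hpK y)
  exact ⟨g ∘ s, hg.comp_continuousOn hs, fun z hz => by
    simp only [Function.comp_apply, hgf, hps z hz]⟩

theorem image_Icc [T2Space X] {γ : unitInterval → X} (hγ : Continuous γ)
    (hinj : Function.Injective γ) {s t : unitInterval} (hst : s ≤ t)
    (hf : ContinuousOn f (γ '' Icc s t)) (h0 : ∀ z ∈ γ '' Icc s t, f z ≠ 0) :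
    HasLogOn f (γ '' Icc s t) := by
  have hinv : ∀ x, Function.invFun γ (γ x) = x := Function.leftInverse_invFun hinj
  let q : ℝ → unitInterval := fun x => projIcc s t hst (projIcc 0 1 zero_le_one x)
  have hq : Continuous q :=
    continuous_subtype_val.comp (continuous_projIcc.comp continuous_projIcc)
  refine of_retract (p := γ ∘ q) (s := Subtype.val ∘ Function.invFun γ) (hγ.comp hq)
    (fun x => mem_image_of_mem γ (projIcc s t hst _).2) ?_ ?_ hf h0
  · let e := (hγ.isClosedEmbedding hinj).isEmbedding.toHomeomorph
    refine ContinuousOn.mono ?_ (image_subset_range γ _)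
    rw [continuousOn_iff_continuous_domRestrict]
    refine (continuous_subtype_val.comp e.symm.continuous).congr fun z => ?_
    obtain ⟨x, rfl⟩ := e.surjective z
    simp [e, hinv]
  · rintro _ ⟨x, hx, rfl⟩
    simp only [q, Function.comp_apply, hinv, projIcc_val, projIcc_of_mem _ hx]

theorem union_of_sub_eq (hA : IsClosed A) (hB : IsClosed B) {g h : X → ℂ}
    (hg : ContinuousOn g A) (hgf : ∀ z ∈ A, Complex.exp (g z) = f z) (hh : ContinuousOn h B)
    (hhf : ∀ z ∈ B, Complex.exp (h z) = f z)
    (hAB : ∀ x ∈ A ∩ B, ∀ y ∈ A ∩ B, g x - h x = g y - h y) : HasLogOn f (A ∪ B) := by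
  classical
  obtain ⟨c, hc1, hc⟩ : ∃ c, Complex.exp c = 1 ∧ ∀ x ∈ A ∩ B, g x = h x + c := by
    rcases (A ∩ B).eq_empty_or_nonempty with hempty | ⟨y, hy⟩
    · exact ⟨0, Complex.exp_zero, by simp [hempty]⟩
    · refine ⟨g y - h y, ?_, fun x hx => by rw [← hAB x hx y hy]; ring⟩
      rw [Complex.exp_sub, hgf y hy.1, ← hhf y hy.2, div_self (Complex.exp_ne_zero _)]
  refine ⟨A.piecewise g fun z => h z + c, ContinuousOn.union_of_isClosed ?_ ?_ hA hB, ?_⟩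
  · exact hg.congr (piecewise_eqOn A _ _)
  · refine (hh.add (continuousOn_const (c := c))).congr fun z hz => ?_
    by_cases hzA : z ∈ A
    · rw [piecewise_eq_of_mem _ _ _ hzA, hc z ⟨hzA, hz⟩, Pi.add_apply]
    · rw [piecewise_eq_of_notMem _ _ _ hzA, Pi.add_apply]
  · intro z hz
    by_cases hzA : z ∈ A
    · rw [piecewise_eq_of_mem _ _ _ hzA, hgf z hzA]
    · rw [piecewise_eq_of_notMem _ _ _ hzA, Complex.exp_add, hc1, mul_one,
        hhf z (hz.resolve_left hzA)]

theorem union (hA : IsClosed A) (hB : IsClosed B) (hfA : HasLogOn f A) (hfB : HasLogOn f B)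
    (hAB : IsPreconnected (A ∩ B)) : HasLogOn f (A ∪ B) := by
  obtain ⟨g, hg, hgf⟩ := hfA
  obtain ⟨h, hh, hhf⟩ := hfB
  refine union_of_sub_eq hA hB hg hgf hh hhf fun x hx y hy => ?_
  refine eq_of_exp_eq_const (g := fun z => g z - h z) (c := 1) hAB
    ((hg.mono inter_subset_left).sub (hh.mono inter_subset_right)) (fun z hz => ?_) hx hy
  rw [Complex.exp_sub, hgf z hz.1, ← hhf z hz.2, div_self (Complex.exp_ne_zero _)]

theorem biUnion {ι : Type*} {M : Set X} {L : ι → Set X} (T : Finset ι) (hM : IsClosed M)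
    (hMf : HasLogOn f M) (hL : ∀ i ∈ T, IsClosed (L i)) (hLf : ∀ i ∈ T, HasLogOn f (L i))
    (hML : ∀ i ∈ T, (M ∩ L i).Subsingleton) (hLL : ∀ i ∈ T, ∀ j ∈ T, i ≠ j → L i ∩ L j ⊆ M) :
    HasLogOn f (M ∪ ⋃ i ∈ T, L i) := by
  classical
  induction T using Finset.induction_on with
  | empty => simpa using hMf
  | insert i T hi ih =>
    simp only [Finset.forall_mem_insert] at hL hLf hML hLL
    have hM' : IsClosed (M ∪ ⋃ j ∈ T, L j) :=
      hM.union (T.finite_toSet.isClosed_biUnion fun j hj => hL.2 j hj)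
    have hinter : (M ∪ ⋃ j ∈ T, L j) ∩ L i ⊆ M ∩ L i := by
      rintro z ⟨hz | hz, hzi⟩
      · exact ⟨hz, hzi⟩
      · obtain ⟨j, hj, hzj⟩ := mem_iUnion₂.1 hz
        exact ⟨(hLL.2 j hj).1 (fun h => hi (h ▸ hj)) ⟨hzj, hzi⟩, hzi⟩
    rw [Finset.set_biUnion_insert, union_comm (L i), ← union_assoc]
    exact union hM' hL.1 (ih hL.2 hLf.2 hML.2 fun j hj => (hLL.2 j hj).2) hLf.1
      (hML.1.anti hinter).isPreconnected

/-- At most one `L i` contains two points of `M`, and then all of `M`, so that it can replace `M` as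
the body to which the others are attached. -/
theorem biUnion_of_ncard_le_two [T1Space X] {ι : Type*} {M : Set X} {L : ι → Set X} (T : Finset ι)
    (hM : M.Finite) (hM2 : M.ncard ≤ 2) (h0 : ∀ z ∈ M, f z ≠ 0) (hL : ∀ i ∈ T, IsClosed (L i))
    (hLf : ∀ i ∈ T, HasLogOn f (L i)) (hLL : ∀ i ∈ T, ∀ j ∈ T, i ≠ j → L i ∩ L j ⊆ M)
    (hLL' : ∀ i ∈ T, ∀ j ∈ T, i ≠ j → (L i ∩ L j).Subsingleton) :
    HasLogOn f (M ∪ ⋃ i ∈ T, L i) := by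
  classical
  by_cases hsub : ∀ i ∈ T, (M ∩ L i).Subsingleton
  · exact biUnion T hM.isClosed (of_finite hM h0) hL hLf hsub hLL
  push Not at hsub
  obtain ⟨i, hi, u, hu, v, hv, huv⟩ := hsub
  have hMi : M ⊆ L i := by
    have hMuv : {u, v} = M := eq_of_subset_of_ncard_le
      (insert_subset hu.1 (singleton_subset_iff.2 hv.1)) (hM2.trans_eq (ncard_pair huv).symm) hM
    exact hMuv ▸ insert_subset hu.2 (singleton_subset_iff.2 hv.2)
  have herase : ∀ j ∈ T.erase i, j ∈ T := fun j => Finset.mem_of_mem_erase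
  refine (biUnion (T.erase i) (hL i hi) (hLf i hi) (fun j hj => hL j (herase j hj))
    (fun j hj => hLf j (herase j hj))
    (fun j hj => hLL' i hi j (herase j hj) (Finset.ne_of_mem_erase hj).symm)
    fun j hj l hl hjl => (hLL j (herase j hj) l (herase l hl) hjl).trans hMi).mono ?_
  refine union_subset (hMi.trans subset_union_left) (iUnion₂_subset fun j hj => ?_)
  by_cases hji : j = i
  · exact hji ▸ subset_union_left
  · exact (subset_biUnion_of_mem (u := L) (Finset.mem_erase.2 ⟨hji, hj⟩)).trans subset_union_right

/-- Two logarithms of `f` on `A` and on `B` differ by `2πi` times an integer at `x` and at `y`; the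
difference `n` of these integers obstructs gluing. With `n'` the obstruction of `f'`, the
logarithms of `f ^ n' * f' ^ (-n)` can be glued. -/
theorem exists_zpow_mul_zpow_union (hA : IsClosed A) (hB : IsClosed B) {x y : X}
    (hAB : A ∩ B = {x, y}) (hfA : HasLogOn f A) (hfB : HasLogOn f B) (hfA' : HasLogOn f' A)
    (hfB' : HasLogOn f' B) :
    ∃ k l : ℤ, (k ≠ 0 ∨ l ≠ 0) ∧ HasLogOn (fun z => f z ^ k * f' z ^ l) (A ∪ B) := by
  have hx : x ∈ A ∩ B := hAB ▸ mem_insert x {y}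
  have hy : y ∈ A ∩ B := hAB ▸ mem_insert_of_mem x rfl
  have hdiff : ∀ f : X → ℂ, HasLogOn f A → HasLogOn f B → ∃ (g h : X → ℂ) (n : ℤ),
      ContinuousOn g A ∧ (∀ z ∈ A, Complex.exp (g z) = f z) ∧ ContinuousOn h B ∧
      (∀ z ∈ B, Complex.exp (h z) = f z) ∧
      (g x - h x) - (g y - h y) = n * (2 * Real.pi * Complex.I) := by
    rintro f ⟨g, hg, hgf⟩ ⟨h, hh, hhf⟩
    obtain ⟨m, hm⟩ := Complex.exp_eq_exp_iff_exists_int.1 ((hgf x hx.1).trans (hhf x hx.2).symm)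
    obtain ⟨n, hn⟩ := Complex.exp_eq_exp_iff_exists_int.1 ((hgf y hy.1).trans (hhf y hy.2).symm)
    exact ⟨g, h, m - n, hg, hgf, hh, hhf, by rw [hm, hn]; push_cast; ring⟩
  obtain ⟨g, h, n, hg, hgf, hh, hhf, hn⟩ := hdiff f hfA hfB
  obtain ⟨g', h', n', hg', hgf', hh', hhf', hn'⟩ := hdiff f' hfA' hfB'
  suffices hglue : ∀ k l : ℤ, k * n + l * n' = 0 →
      HasLogOn (fun z => f z ^ k * f' z ^ l) (A ∪ B) by
    by_cases hn0 : n = 0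
    · exact ⟨1, 0, Or.inl one_ne_zero, hglue 1 0 (by simp [hn0])⟩
    · exact ⟨n', -n, Or.inr (neg_ne_zero.2 hn0), hglue n' (-n) (by ring)⟩
  intro k l hkl
  refine union_of_sub_eq (g := fun z => k * g z + l * g' z) (h := fun z => k * h z + l * h' z)
    hA hB (by fun_prop) (fun z hz => ?_) (by fun_prop) (fun z hz => ?_) ?_
  · rw [Complex.exp_add, Complex.exp_int_mul, Complex.exp_int_mul, hgf z hz, hgf' z hz]
  · rw [Complex.exp_add, Complex.exp_int_mul, Complex.exp_int_mul, hhf z hz, hhf' z hz]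
  · have hxy : k * g x + l * g' x - (k * h x + l * h' x) =
        k * g y + l * g' y - (k * h y + l * h' y) := by
      have hkl' : (k * n + l * n' : ℂ) = 0 := mod_cast hkl
      linear_combination (k : ℂ) * hn + l * hn' + 2 * Real.pi * Complex.I * hkl'
    rw [hAB]
    rintro z (rfl | rfl) w (rfl | rfl)
    exacts [rfl, hxy, hxy.symm, rfl]

end HasLogOn

end HasLogOn

section Separation

variable {X : Type*} [TopologicalSpace X]

theorem closure_connectedComponentIn_inter_subset (O : Set X) (a : X) :
    closure (connectedComponentIn O a) ∩ O ⊆ connectedComponentIn O a := by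
  rintro z ⟨hz, hzO⟩
  have ha : a ∈ O := by
    by_contra ha
    simp [connectedComponentIn_eq_empty ha] at hz
  have hpre : IsPreconnected (insert z (connectedComponentIn O a)) :=
    isPreconnected_connectedComponentIn.subset_closure (subset_insert _ _)
      (insert_subset hz subset_closure)
  exact hpre.subset_connectedComponentIn (mem_insert_of_mem _ (mem_connectedComponentIn ha))
    (insert_subset hzO (connectedComponentIn_subset _ _)) (mem_insert _ _)

theorem frontier_connectedComponentIn_subset [LocallyConnectedSpace X] {O : Set X} (hO : IsOpen O)
    (a : X) : frontier (connectedComponentIn O a) ⊆ Oᶜ := by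
  intro z hz hzO
  rw [hO.connectedComponentIn.frontier_eq] at hz
  exact hz.2 (closure_connectedComponentIn_inter_subset O a ⟨hz.1, hzO⟩)

variable {E : Type*} [NormedAddCommGroup E] [NormedSpace ℝ E]

theorem isPreconnected_compl_closedBall_zero (h : 1 < Module.rank ℝ E) {r : ℝ} (hr : 0 ≤ r) :
    IsPreconnected (Metric.closedBall (0 : E) r)ᶜ := by
  have hpolar : (Metric.closedBall (0 : E) r)ᶜ =
      (fun q : ℝ × E => q.1 • q.2) '' (Ioi r ×ˢ Metric.sphere 0 1) := by
    ext z
    simp only [mem_compl_iff, Metric.mem_closedBall, dist_zero_right, not_le, mem_image,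
      mem_prod, mem_Ioi, Metric.mem_sphere, Prod.exists]
    constructor
    · intro hz
      have hz0 : ‖z‖ ≠ 0 := (hr.trans_lt hz).ne'
      exact ⟨‖z‖, ‖z‖⁻¹ • z, ⟨hz, by rw [norm_smul, norm_inv, norm_norm, inv_mul_cancel₀ hz0]⟩,
        by rw [smul_smul, mul_inv_cancel₀ hz0, one_smul]⟩
    · rintro ⟨s, w, ⟨hs, hw⟩, rfl⟩
      rw [norm_smul, hw, mul_one, Real.norm_eq_abs]
      exact hs.trans_le (le_abs_self s)
  rw [hpolar]
  exact (isPreconnected_Ioi.prod (isPreconnected_sphere h 0 1)).image _ (by fun_prop)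

theorem isBounded_or_isBounded_connectedComponentIn_compl (h : 1 < Module.rank ℝ E) {K : Set E}
    (hK : Bornology.IsBounded K) {a b : E} (hb : b ∉ K) (hab : b ∉ connectedComponentIn Kᶜ a) :
    Bornology.IsBounded (connectedComponentIn Kᶜ a) ∨
      Bornology.IsBounded (connectedComponentIn Kᶜ b) := by
  obtain ⟨r, hr0, hr⟩ := hK.subset_closedBall_lt 0 0
  by_contra! hunb
  have hmeet : ∀ V : Set E, ¬ Bornology.IsBounded V → ∃ x ∈ V, x ∈ (Metric.closedBall 0 r)ᶜ :=
    fun V hV => not_subset.1 fun hsub => hV (Metric.isBounded_closedBall.subset hsub)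
  obtain ⟨x, hx, hxr⟩ := hmeet _ hunb.1
  obtain ⟨y, hy, hyr⟩ := hmeet _ hunb.2
  have hxy := (isPreconnected_compl_closedBall_zero h hr0.le).subset_connectedComponentIn hxr
    (compl_subset_compl.2 hr) hyr
  rw [connectedComponentIn_eq hx, connectedComponentIn_eq hxy, ← connectedComponentIn_eq hy] at hab
  exact hab (mem_connectedComponentIn hb)

theorem eq_zero_of_eq_zpow_of_norm_gt {F : ℂ → ℂ} (hF : Continuous F) (h0 : ∀ z, F z ≠ 0) {p : ℂ}
    {n : ℤ} {r : ℝ} (hr : ∀ z, r < ‖z - p‖ → F z = (z - p) ^ n) : n = 0 := by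
  obtain ⟨G, hG, hGF⟩ := exists_continuous_log hF h0
  set R : ℝ := |r| + 1
  have hFcircle : ∀ θ, F (circleMap p R θ) = (R * Complex.exp (θ * Complex.I)) ^ n := by
    intro θ
    have hsub : circleMap p R θ - p = R * Complex.exp (θ * Complex.I) := by simp [circleMap]
    rw [hr, hsub]
    rw [circleMap_sub_center, norm_circleMap_zero, abs_of_pos (by positivity)]
    linarith [le_abs_self r]
  have hconst := eq_of_exp_eq_const (S := (univ : Set ℝ)) isPreconnected_univ
    (g := fun θ => G (circleMap p R θ) - n * (θ * Complex.I)) (c := (R : ℂ) ^ n)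
    (by have := continuous_circleMap p R; fun_prop) (fun θ _ => by
      rw [Complex.exp_sub, hGF, hFcircle, mul_zpow, ← Complex.exp_int_mul, mul_div_assoc,
        div_self (Complex.exp_ne_zero _), mul_one])
    (mem_univ 0) (mem_univ (2 * Real.pi))
  have hperiod : circleMap p R (2 * Real.pi) = circleMap p R 0 := by
    simpa using periodic_circleMap p R 0
  simp only [hperiod] at hconst
  have hn : (n : ℂ) * (2 * Real.pi * Complex.I) = 0 := by
    push_cast at hconst
    linear_combination hconst
  exact_mod_cast (mul_eq_zero.1 hn).resolve_right Complex.two_pi_I_ne_zero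

end Separation

section PlaneSeparation

/-- The identification of the plane with the complex numbers, through which logarithms of
quotients of displacement vectors make sense. -/
noncomputable def coord : Plane ≃ₗᵢ[ℝ] ℂ := Complex.orthonormalBasisOneI.repr.symm

/-- The quotient `(z - a) / (z - b)` of complex numbers, with the junk value `0` at `z = b`. -/
noncomputable def quot (a b z : Plane) : ℂ := coord (z - a) / coord (z - b)

variable {K : Set Plane} {a b c z : Plane}

theorem one_lt_rank_plane : 1 < Module.rank ℝ Plane := by
  rw [← Module.finrank_eq_rank]
  simp

theorem continuous_coord_sub (a : Plane) : Continuous fun z => coord (z - a) :=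
  coord.continuous.comp (continuous_id.sub continuous_const)

theorem coord_sub_ne_zero : coord (z - a) ≠ 0 ↔ z ≠ a := by
  rw [ne_eq, map_eq_zero_iff coord coord.injective, sub_eq_zero]

theorem quot_mul_quot (hz : z ≠ b) : quot a b z * quot b c z = quot a c z :=
  div_mul_div_cancel₀ (coord_sub_ne_zero.2 hz)

theorem inv_quot (a b z : Plane) : (quot a b z)⁻¹ = quot b a z :=
  inv_div _ _

theorem quot_ne_zero (ha : z ≠ a) (hb : z ≠ b) : quot a b z ≠ 0 :=
  div_ne_zero (coord_sub_ne_zero.2 ha) (coord_sub_ne_zero.2 hb)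

theorem continuousOn_quot (a : Plane) (hb : b ∉ K) : ContinuousOn (quot a b) K :=
  (continuous_coord_sub a).continuousOn.div (continuous_coord_sub b).continuousOn fun _ hz =>
    coord_sub_ne_zero.2 (ne_of_mem_of_not_mem hz hb)

theorem hasLogOn_quot_of_dist_lt (h : ∀ z ∈ K, dist a b < dist z b) : HasLogOn (quot a b) K := by
  have hb : b ∉ K := fun hb => (h b hb).not_ge (by simp [dist_nonneg])
  have hslit : ∀ z ∈ K, quot a b z ∈ Complex.slitPlane := by
    intro z hz
    have hquot : quot a b z = 1 + coord (b - a) / coord (z - b) := by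
      rw [quot, ← sub_add_sub_cancel z b a, map_add, add_div,
        div_self (coord_sub_ne_zero.2 (ne_of_mem_of_not_mem hz hb))]
    rw [hquot]
    apply Complex.mem_slitPlane_of_norm_lt_one
    rw [norm_div, coord.norm_map, coord.norm_map, ← dist_eq_norm, ← dist_eq_norm, dist_comm b a,
      div_lt_one (dist_nonneg.trans_lt (h z hz))]
    exact h z hz
  exact ⟨fun z => Complex.log (quot a b z), (continuousOn_quot a hb).clog hslit,
    fun z hz => Complex.exp_log (Complex.slitPlane_ne_zero (hslit z hz))⟩

theorem hasLogOn_quot_of_isPreconnected (hK : IsClosed K) {S : Set Plane} (hS : IsPreconnected S)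
    (hSK : S ⊆ Kᶜ) (ha : a ∈ S) (hb : b ∈ S) : HasLogOn (quot a b) K := by
  refine hS.induction₂' (fun x y => x ∈ S → y ∈ S → HasLogOn (quot x y) K) ?_ ?_ ha hb ha hb
  · intro x hx
    obtain ⟨r, hr, hrK⟩ := Metric.isOpen_iff.1 hK.isOpen_compl x (hSK hx)
    filter_upwards [mem_nhdsWithin_of_mem_nhds (Metric.ball_mem_nhds x (half_pos hr))] with y hy
    have hxy : HasLogOn (quot x y) K := hasLogOn_quot_of_dist_lt fun z hz => by
      have hzx : r ≤ dist z x := not_lt.1 fun hzx => hrK hzx hz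
      have hyx : dist y x < r / 2 := hy
      linarith [dist_triangle z y x, dist_comm x y]
    exact ⟨fun _ _ => hxy, fun _ _ => by simpa only [inv_quot] using hxy.inv⟩
  · intro x y z hx hy hz hxy hyz _ _
    exact ((hxy hx hy).mul (hyz hy hz)).congr fun w hw =>
      quot_mul_quot (ne_of_mem_of_not_mem hw (hSK hy))

/-- Extending the logarithm from `frontier U` to `U` by Tietze, one obtains a nonvanishing function
on the whole plane that equals `(z - a) ^ k` outside `U`, so `k` is its winding number around a
large circle. -/
theorem eq_zero_of_hasLogOn_frontier {U : Set Plane} (hU : IsOpen U)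
    (hbd : Bornology.IsBounded U) (ha : a ∈ U) {f : Plane → ℂ} (hf : ContinuousOn f (closure U))
    (hf0 : ∀ z ∈ closure U, f z ≠ 0) {k : ℤ}
    (h : HasLogOn (fun z => coord (z - a) ^ k * f z) (frontier U)) : k = 0 := by
  classical
  obtain ⟨g, hg, hgf⟩ := h
  obtain ⟨g', hg'⟩ := ContinuousMap.exists_restrict_eq (Y := ℂ) isClosed_frontier
    ⟨(frontier U).domRestrict g, hg.domRestrict⟩
  have hg'f : ∀ z ∈ frontier U, Complex.exp (g' z) = coord (z - a) ^ k * f z := fun z hz =>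
    (congrArg Complex.exp (by simpa using DFunLike.congr_fun hg' ⟨z, hz⟩)).trans (hgf z hz)
  let F : Plane → ℂ := U.piecewise (fun z => Complex.exp (g' z) / f z) fun z => coord (z - a) ^ k
  have hne : ∀ z ∉ U, coord (z - a) ≠ 0 := fun z hz =>
    coord_sub_ne_zero.2 (ne_of_mem_of_not_mem ha hz).symm
  have hF : Continuous F := by
    refine continuous_piecewise (fun z hz => ?_) ?_ ?_
    · rw [hg'f z hz, mul_div_cancel_right₀ _ (hf0 z (frontier_subset_closure hz))]
    · exact (Complex.continuous_exp.comp g'.continuous).continuousOn.div hf hf0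
    · rw [hU.isClosed_compl.closure_eq]
      exact (continuous_coord_sub a).continuousOn.zpow₀ k fun z hz => Or.inl (hne z hz)
  have hF0 : ∀ z, F z ≠ 0 := by
    intro z
    by_cases hz : z ∈ U
    · rw [show F z = _ from piecewise_eq_of_mem _ _ _ hz]
      exact div_ne_zero (Complex.exp_ne_zero _) (hf0 z (subset_closure hz))
    · rw [show F z = _ from piecewise_eq_of_notMem _ _ _ hz]
      exact zpow_ne_zero k (hne z hz)
  obtain ⟨r, hr⟩ := hbd.subset_closedBall a
  refine eq_zero_of_eq_zpow_of_norm_gt (F := F ∘ coord.symm) (hF.comp coord.symm.continuous)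
    (fun z => hF0 _) (p := coord a) (r := r) fun z hz => ?_
  have hzU : coord.symm z ∉ U := fun hzU => by
    have hle := hr hzU
    rw [Metric.mem_closedBall, ← coord.dist_map, coord.apply_symm_apply, dist_eq_norm] at hle
    exact hle.not_gt hz
  simp [F, piecewise_eq_of_notMem _ _ _ hzU]

/-- All bounded components are handled by `eq_zero_of_hasLogOn_frontier`, and the exponent of the
at most one point in the unbounded component is then determined by the vanishing of the sum. -/
theorem eq_zero_of_hasLogOn_prod (hK : IsCompact K) {ι : Type*} [Fintype ι] {a : ι → Plane}
    (ha : ∀ i, a i ∉ K) (hsep : ∀ i j, i ≠ j → a j ∉ connectedComponentIn Kᶜ (a i)) {k : ι → ℤ}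
    (hk : ∑ i, k i = 0) (h : HasLogOn (fun z => ∏ i, coord (z - a i) ^ k i) K) (i : ι) :
    k i = 0 := by
  classical
  have hbounded : ∀ j, Bornology.IsBounded (connectedComponentIn Kᶜ (a j)) → k j = 0 := by
    intro j hbd
    have hne : ∀ z ∈ closure (connectedComponentIn Kᶜ (a j)), ∀ l ∈ Finset.univ.erase j,
        coord (z - a l) ≠ 0 := fun z hz l hl => coord_sub_ne_zero.2 <| by
      rintro rfl
      exact hsep j l (Finset.ne_of_mem_erase hl).symm
        (closure_connectedComponentIn_inter_subset _ _ ⟨hz, ha l⟩)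
    refine eq_zero_of_hasLogOn_frontier hK.isClosed.isOpen_compl.connectedComponentIn hbd
      (mem_connectedComponentIn (ha j))
      (f := fun z => ∏ l ∈ Finset.univ.erase j, coord (z - a l) ^ k l) ?_
      (fun z hz => Finset.prod_ne_zero_iff.2 fun l hl => zpow_ne_zero _ (hne z hz l hl)) ?_
    · exact continuousOn_finsetProd _ fun l hl =>
        (continuous_coord_sub (a l)).continuousOn.zpow₀ _ fun z hz => Or.inl (hne z hz l hl)
    · refine (h.mono ?_).congr fun z _ => (Finset.mul_prod_erase _ _ (Finset.mem_univ j)).symm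
      simpa using frontier_connectedComponentIn_subset hK.isClosed.isOpen_compl (a j)
  by_contra hi
  have hothers : ∀ j, j ≠ i → k j = 0 := fun j hj => hbounded j <|
    (isBounded_or_isBounded_connectedComponentIn_compl one_lt_rank_plane hK.isBounded (ha j)
      (hsep i j hj.symm)).resolve_left fun hbd => hi (hbounded i hbd)
  rw [Fintype.sum_eq_single i hothers] at hk
  exact hi hk

theorem mem_connectedComponentIn_of_hasLogOn_quot (hK : IsCompact K) (ha : a ∉ K) (hb : b ∉ K)
    (h : HasLogOn (quot a b) K) : b ∈ connectedComponentIn Kᶜ a := by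
  by_contra hab
  have hba : a ∉ connectedComponentIn Kᶜ b := fun hba =>
    hab (connectedComponentIn_eq hba ▸ mem_connectedComponentIn hb)
  have h10 := eq_zero_of_hasLogOn_prod hK (a := ![a, b]) (k := ![1, -1])
    (Fin.forall_fin_two.2 ⟨ha, hb⟩) (by simp [Fin.forall_fin_two, hab, hba]) (by simp)
    (h.congr fun z _ => by simp [quot, div_eq_mul_inv]) 0
  exact one_ne_zero h10

end PlaneSeparation

/-! ### Edge connectivity -/

section EdgeConnectivity

variable {V : Type*} {H : SimpleGraph V} {k : ℕ}

theorem reachable_deleteEdges_of_notMem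
    (h : ∀ S : Set V, S.encard < k → (H.induce Sᶜ).Preconnected) {F : Set (Sym2 V)}
    (hF : F.encard < k) {x y : V} (hxy : s(x, y) ∉ F) : (H.deleteEdges F).Reachable x y := by
  have hend : ∀ d ∈ {d ∈ F | ¬ d.IsDiag}, ∃ z ∈ d, z ≠ x ∧ z ≠ y := by
    rintro d ⟨hdF, hd⟩
    induction d with
    | h u v =>
      by_contra! hcon
      simp only [Sym2.mem_iff, forall_eq_or_imp, forall_eq, Sym2.mk_isDiag_iff] at hcon hd
      have huv : s(u, v) = s(x, y) := Sym2.eq_iff.2 (by grind)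
      exact hxy (huv ▸ hdF)
  have : Nonempty V := ⟨x⟩
  choose! c hcd hc using hend
  set S := c '' {d ∈ F | ¬ d.IsDiag}
  have hSk : S.encard < k :=
    ((encard_image_le _ _).trans (encard_le_encard (sep_subset _ _))).trans_lt hF
  have hxS : x ∉ S := by
    rintro ⟨d, hd, rfl⟩
    exact (hc d hd).1 rfl
  have hyS : y ∉ S := by
    rintro ⟨d, hd, rfl⟩
    exact (hc d hd).2 rfl
  let φ : H.induce Sᶜ →g H.deleteEdges F :=
    { toFun := Subtype.val
      map_rel' := fun {u v} huv => by
        refine SimpleGraph.deleteEdges_adj.2 ⟨huv, fun hF => ?_⟩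
        have hd : s(u.1, v.1) ∈ {d ∈ F | ¬ d.IsDiag} := ⟨hF, by simpa using H.ne_of_adj huv⟩
        rcases Sym2.mem_iff.1 (hcd _ hd) with h | h
        · exact u.2 ⟨_, hd, h⟩
        · exact v.2 ⟨_, hd, h⟩ }
  exact (h S hSk ⟨x, hxS⟩ ⟨y, hyS⟩).map φ

/-- If deleting `F` separates `x` from `y`, then `F` contains `s(x, z)` or `s(z, y)` for every
`z ≠ x`, which are too many edges. -/
theorem isEdgeConnected_of_induce_preconnected (hk : k < ENat.card V)
    (h : ∀ S : Set V, S.encard < k → (H.induce Sᶜ).Preconnected) : H.IsEdgeConnected k := by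
  classical
  intro x y F hF
  by_contra hxy
  have hne : x ≠ y := by
    rintro rfl
    exact hxy .rfl
  let g : V → Sym2 V := fun z => if s(x, z) ∈ F then s(x, z) else s(z, y)
  have hgF : MapsTo g {x}ᶜ F := by
    intro z _
    by_cases hxz : s(x, z) ∈ F
    · simp [g, hxz]
    · by_contra hzy
      simp only [g, hxz, if_false] at hzy
      exact hxy ((reachable_deleteEdges_of_notMem h hF hxz).trans
        (reachable_deleteEdges_of_notMem h hF hzy))
  have hginj : InjOn g {x}ᶜ := by
    intro z hz z' hz' hzz'
    simp only [mem_compl_iff, mem_singleton_iff] at hz hz'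
    simp only [g] at hzz'
    split_ifs at hzz' <;> simp only [Sym2.eq_iff] at hzz' <;> grind
  have hcard : ({x}ᶜ : Set V).encard + 1 = ENat.card V := by
    rw [← encard_singleton x, add_comm, encard_add_encard_compl, encard_univ]
  have hlt := (encard_le_encard_of_injOn hgF hginj).trans_lt hF
  rw [← hcard] at hk
  exact hlt.not_ge (Order.le_of_lt_add_one hk)

end EdgeConnectivity

/-! ### Vizing's theorem for multigraphs -/

section PathComponents

variable {V : Type*} {H : SimpleGraph V} {a b c v r : V}

theorem eq_of_isPath_of_isPath (hH : ∀ z, (H.neighborSet z).encard ≤ 2)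
    (hb : (H.neighborSet b).Subsingleton) (hc : (H.neighborSet c).Subsingleton)
    (hr : H.Adj v r) {P : H.Walk v b} {Q : H.Walk v c} (hP : P.IsPath) (hQ : Q.IsPath)
    (hrP : r ∉ P.support) (hrQ : r ∉ Q.support) : b = c := by
  induction P generalizing r with
  | nil =>
    cases Q with
    | nil => rfl
    | cons hy Q => exact absurd (by simp [hb hr hy]) hrQ
  | @cons v x b hx P ih =>
    cases Q with
    | nil => exact absurd (by simp [hc hr hx]) hrP
    | @cons _ y _ hy Q =>
      rw [SimpleGraph.Walk.cons_isPath_iff] at hP hQ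
      obtain rfl : x = y := by
        by_contra hxy
        have hrx : r ≠ x := fun h => hrP (by simp [h])
        have hry : r ≠ y := fun h => hrQ (by simp [h])
        have hle : ({r, x, y} : Set V).encard ≤ 2 :=
          (encard_le_encard (by rintro z (rfl | rfl | rfl) <;> assumption)).trans (hH v)
        rw [encard_eq_three.2 ⟨r, x, y, hrx, hry, hxy, rfl⟩] at hle
        exact absurd hle (by decide)
      exact ih hb hx.symm hP.1 hQ.1 hP.2 hQ.2

theorem eq_of_reachable_of_subsingleton_neighborSet (hH : ∀ z, (H.neighborSet z).encard ≤ 2)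
    (ha : (H.neighborSet a).Subsingleton) (hb : (H.neighborSet b).Subsingleton)
    (hc : (H.neighborSet c).Subsingleton) (hab : H.Reachable a b) (hac : H.Reachable a c)
    (nab : a ≠ b) (nac : a ≠ c) : b = c := by
  classical
  obtain ⟨P, hP⟩ := hab.exists_isPath
  obtain ⟨Q, hQ⟩ := hac.exists_isPath
  cases P with
  | nil => exact absurd rfl nab
  | cons hx P =>
    cases Q with
    | nil => exact absurd rfl nac
    | cons hy Q =>
      obtain rfl := ha hx hy
      rw [SimpleGraph.Walk.cons_isPath_iff] at hP hQ
      exact eq_of_isPath_of_isPath hH hb hc hx.symm hP.1 hQ.1 hP.2 hQ.2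

end PathComponents

namespace EdgeColoring

open Function (update)

variable {V E C : Type*}

/-- The edge coloring `c` of the multigraph with edges `e` joining the two elements of `ends e` is
proper on the set `S` of edges. Partial colorings, as in the proof of Vizing's theorem, are
encoded as total functions whose values outside `S` are irrelevant. -/
def IsProperOn (ends : E → Sym2 V) (c : E → C) (S : Set E) : Prop :=
  S.Pairwise fun e e' => ∀ v ∈ ends e, v ∈ ends e' → c e ≠ c e'

/-- The color `a` is missing at the vertex `v`: no edge of `S` at `v` has it. -/
def Missing (ends : E → Sym2 V) (c : E → C) (S : Set E) (v : V) (a : C) : Prop :=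
  ∀ e ∈ S, v ∈ ends e → c e ≠ a

/-- A Vizing fan at `w` from `v` to `u`: a sequence of edges of `S` at `w` in which the color of
each edge is missing at the end of the previous one, and at `v` for the first edge. -/
def Fan (ends : E → Sym2 V) (c : E → C) (S : Set E) (w : V) : V → List E → V → Prop
  | v, [], u => v = u
  | v, f :: l, u => ∃ v', f ∈ S ∧ ends f = s(w, v') ∧ Missing ends c S v (c f) ∧
      Fan ends c S w v' l u

/-- The vertices reached by a fan at `w` from `v` without repeated edges. -/
def fanEnds (ends : E → Sym2 V) (c : E → C) (S : Set E) (w v : V) : Set V :=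
  {u | ∃ l : List E, l.Nodup ∧ Fan ends c S w v l u}

/-- The graph whose components are the Kempe chains for the colors `α` and `β`. -/
def kempeGraph (ends : E → Sym2 V) (c : E → C) (S : Set E) (α β : C) : SimpleGraph V :=
  .fromEdgeSet (ends '' {e ∈ S | c e = α ∨ c e = β})

variable {ends : E → Sym2 V} {c : E → C} {S : Set E} {x : E} {w v u u' z : V} {a b α β : C}

theorem IsProperOn.eq (hc : IsProperOn ends c S) {e e' : E} (he : e ∈ S) (he' : e' ∈ S)
    (hz : z ∈ ends e) (hz' : z ∈ ends e') (h : c e = c e') : e = e' :=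
  by_contra fun hne => hc he he' hne z hz hz' h

section Update

variable [DecidableEq E]

theorem update_apply_of_notMem (hx : x ∉ S) {e : E} (he : e ∈ S) : update c x a e = c e :=
  Function.update_of_ne (ne_of_mem_of_not_mem he hx) _ _

theorem IsProperOn.update_insert (hc : IsProperOn ends c S) (hxS : x ∉ S)
    (ha : ∀ v ∈ ends x, Missing ends c S v a) :
    IsProperOn ends (update c x a) (insert x S) := by
  refine (pairwise_insert_of_notMem hxS).2 ⟨fun e he e' he' hne v hv hv' => ?_, fun e he => ?_⟩
  · rw [update_apply_of_notMem hxS he, update_apply_of_notMem hxS he']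
    exact hc he he' hne v hv hv'
  · rw [Function.update_self, update_apply_of_notMem hxS he]
    exact ⟨fun v hv hve => (ha v hv e he hve).symm, fun v hve hv => ha v hv e he hve⟩

theorem Missing.update_insert (h : Missing ends c S z b) (hxS : x ∉ S) (hab : a ≠ b) :
    Missing ends (update c x a) (insert x S) z b := by
  rintro e (rfl | he) hz
  · rwa [Function.update_self]
  · rw [update_apply_of_notMem hxS he]
    exact h e he hz

end Update

theorem Missing.mono {T : Set E} (h : Missing ends c S z a) (hT : T ⊆ S) :
    Missing ends c T z a := fun e he => h e (hT he)

theorem fan_append {l₁ l₂ : List E} : Fan ends c S w v (l₁ ++ l₂) u ↔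
    ∃ m, Fan ends c S w v l₁ m ∧ Fan ends c S w m l₂ u := by
  induction l₁ generalizing v with
  | nil => simp [Fan]
  | cons f l ih =>
    simp only [List.cons_append, Fan, ih]
    constructor
    · rintro ⟨v', hf, hv', hm, m, h₁, h₂⟩
      exact ⟨m, ⟨v', hf, hv', hm, h₁⟩, h₂⟩
    · rintro ⟨m, ⟨v', hf, hv', hm, h₁⟩, h₂⟩
      exact ⟨v', hf, hv', hm, m, h₁, h₂⟩

theorem fan_append_singleton {l : List E} {g : E} : Fan ends c S w v (l ++ [g]) u ↔
    ∃ m, Fan ends c S w v l m ∧ g ∈ S ∧ ends g = s(w, u) ∧ Missing ends c S m (c g) := by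
  simp [fan_append, Fan]

theorem Fan.transfer {c' : E → C} {S' : Set E} {l : List E} (h : Fan ends c S w v l u)
    (ht : ∀ l₁ g m, l₁ ++ [g] <+: l → Fan ends c S w v l₁ m → g ∈ S → w ∈ ends g →
      Missing ends c S m (c g) → g ∈ S' ∧ Missing ends c' S' m (c' g)) :
    Fan ends c' S' w v l u := by
  induction l generalizing v with
  | nil => exact h
  | cons f l ih =>
    obtain ⟨v', hf, hv', hm, hF⟩ := h
    obtain ⟨hf', hm'⟩ := ht [] f v (by simp) rfl hf (hv' ▸ Sym2.mem_mk_left w v') hm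
    refine ⟨v', hf', hv', hm', ih hF fun l₁ g m hl hF₁ => ?_⟩
    exact ht (f :: l₁) g m (by simpa using hl) ⟨v', hf, hv', hm, hF₁⟩

theorem Fan.ne (hloop : ∀ e, ¬ (ends e).IsDiag) {l : List E} (h : Fan ends c S w v l u)
    (hv : v ≠ w) : u ≠ w := by
  induction l generalizing v with
  | nil => exact h ▸ hv
  | cons f l ih =>
    obtain ⟨v', -, hv', -, hF⟩ := h
    exact ih hF fun heq => hloop f (by simp [hv', heq])

-- Moving the color of each fan edge to its predecessor frees the last edge, which can get `a`.
theorem Fan.exists_isProperOn_insert {l : List E} (hF : Fan ends c S w v l u)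
    (hc : IsProperOn ends c S) (hxS : x ∉ S) (hx : ends x = s(w, v)) (hl : l.Nodup)
    (hw : Missing ends c S w a) (hu : Missing ends c S u a) :
    ∃ c' : E → C, IsProperOn ends c' (insert x S) := by
  classical
  induction l generalizing c x v S with
  | nil =>
    obtain rfl : v = u := hF
    exact ⟨update c x a, hc.update_insert hxS (by simp [hx, hw, hu])⟩
  | cons f l ih =>
    obtain ⟨v', hf, hv', hm, hF⟩ := hF
    have hwf : w ∈ ends f := hv' ▸ Sym2.mem_mk_left w v'
    obtain ⟨hfl, hl⟩ := List.nodup_cons.1 hl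
    have hsub : S \ {f} ⊆ S := sdiff_subset
    have hxS' : x ∉ S \ {f} := fun h => hxS h.1
    have hfS' : f ∉ insert x (S \ {f}) := fun h =>
      h.elim (fun h => hxS (h ▸ hf)) fun h => h.2 rfl
    have hmw : Missing ends c (S \ {f}) w (c f) := fun e he hwe =>
      hc he.1 hf he.2 w hwe hwf
    have hup : ∀ z b, Missing ends c S z b → c f ≠ b →
        Missing ends (update c x (c f)) (insert x (S \ {f})) z b := fun z b hz hb =>
      (hz.mono hsub).update_insert hxS' hb
    have hinsert : insert f (insert x (S \ {f})) = insert x S := by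
      rw [insert_comm, insert_sdiff_singleton, insert_eq_of_mem hf]
    rw [← hinsert]
    refine ih (hF.transfer fun l₁ g m hlg _ hg hwg hmg => ?_) ?_ hfS' hv' hl
      (hup w a hw (hw f hf hwf)) (hup u a hu (hw f hf hwf))
    · have hgf : g ≠ f := fun h => hfl (h ▸ hlg.subset (by simp))
      rw [update_apply_of_notMem hxS hg]
      exact ⟨Or.inr ⟨hg, hgf⟩, hup m _ hmg (hc hf hg hgf.symm w hwf hwg)⟩
    · refine IsProperOn.update_insert (hc.mono hsub) hxS' fun z hz => ?_
      rw [hx, Sym2.mem_iff] at hz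
      rcases hz with rfl | rfl
      · exact hmw
      · exact hm.mono hsub

theorem IsProperOn.exists_kempe_swap [DecidableEq C] (hc : IsProperOn ends c S) (α β : C)
    {P : Set V} (hP : ∀ p q, (kempeGraph ends c S α β).Adj p q → p ∈ P → q ∈ P) :
    ∃ c' : E → C, IsProperOn ends c' S ∧
      (∀ z ∈ P, ∀ e ∈ S, z ∈ ends e → c' e = Equiv.swap α β (c e)) ∧
      ∀ z ∉ P, ∀ e ∈ S, z ∈ ends e → c' e = c e := by
  classical
  let c' : E → C := fun e => if ∃ z ∈ ends e, z ∈ P then Equiv.swap α β (c e) else c e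
  have hin : ∀ z ∈ P, ∀ e ∈ S, z ∈ ends e → c' e = Equiv.swap α β (c e) :=
    fun z hzP e _ hz => if_pos ⟨z, hz, hzP⟩
  have hout : ∀ z ∉ P, ∀ e ∈ S, z ∈ ends e → c' e = c e := by
    intro z hzP e he hz
    by_cases h : ∃ y ∈ ends e, y ∈ P
    · obtain ⟨y, hy, hyP⟩ := h
      have hyz : y ≠ z := ne_of_mem_of_not_mem hyP hzP
      have hcol : ¬ (c e = α ∨ c e = β) := fun hcol => hzP <| hP y z
        ⟨⟨e, ⟨he, hcol⟩, (Sym2.mem_and_mem_iff hyz).1 ⟨hy, hz⟩⟩, hyz⟩ hyP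
      rw [not_or] at hcol
      rw [hin y hyP e he hy, Equiv.swap_apply_of_ne_of_ne hcol.1 hcol.2]
    · exact if_neg h
  refine ⟨c', fun e he e' he' hne z hz hz' => ?_, hin, hout⟩
  by_cases hzP : z ∈ P
  · rw [hin z hzP e he hz, hin z hzP e' he' hz', (Equiv.swap α β).injective.ne_iff]
    exact hc he he' hne z hz hz'
  · rw [hout z hzP e he hz, hout z hzP e' he' hz']
    exact hc he he' hne z hz hz'

theorem Fan.reachable_kempeGraph {l : List E} (hF : Fan ends c S w v l u)
    (hno : ¬ ∃ c' : E → C, IsProperOn ends c' (insert x S)) (hc : IsProperOn ends c S)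
    (hxS : x ∉ S) (hx : ends x = s(w, v)) (hl : l.Nodup) (hw : Missing ends c S w α)
    (hu : Missing ends c S u β) : (kempeGraph ends c S α β).Reachable w u := by
  classical
  induction h : l.length using Nat.strong_induction_on generalizing l u with | _ n ih
  by_contra hwu
  let P : Set V := {z | (kempeGraph ends c S α β).Reachable u z}
  obtain ⟨c', hc', hin, hout⟩ := hc.exists_kempe_swap α β (P := P)
    fun p q hpq hp => hp.trans hpq.reachable
  have hwP : w ∉ P := fun h => hwu h.symm
  have hmissin : ∀ z ∈ P, ∀ a, Missing ends c S z a → Missing ends c' S z (Equiv.swap α β a) :=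
    fun z hz a ha e he hze => by
      rw [hin z hz e he hze, (Equiv.swap α β).injective.ne_iff]
      exact ha e he hze
  have hmissout : ∀ z ∉ P, ∀ a, Missing ends c S z a → Missing ends c' S z a :=
    fun z hz a ha e he hze => by
      rw [hout z hz e he hze]
      exact ha e he hze
  have hu' : Missing ends c' S u α := by
    simpa using hmissin u (SimpleGraph.Reachable.refl u) β hu
  refine hno (Fan.exists_isProperOn_insert (hF.transfer fun l₁ g m hlg hF₁ hg hwg hm => ?_) hc'
    hxS hx hl (hmissout w hwP α hw) hu')
  rw [hout w hwP g hg hwg]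
  refine ⟨hg, ?_⟩
  by_cases hmP : m ∈ P
  · have hgβ : c g ≠ β := fun hgβ => hwu <| by
      have hlen := hlg.length_le
      rw [List.length_append, List.length_singleton] at hlen
      exact (ih l₁.length (by omega) hF₁
        (hl.sublist ((List.sublist_append_left _ _).trans hlg.sublist)) (hgβ ▸ hm) rfl).trans
        hmP.symm
    have := hmissin m hmP _ hm
    rwa [Equiv.swap_apply_of_ne_of_ne (hw g hg hwg) hgβ] at this
  · exact hmissout m hmP _ hm

theorem IsProperOn.encard_neighborSet_kempeGraph_le (hc : IsProperOn ends c S) {A : Set C}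
    (hA : ∀ e ∈ S, z ∈ ends e → c e = α ∨ c e = β → c e ∈ A) :
    ((kempeGraph ends c S α β).neighborSet z).encard ≤ A.encard := by
  have hedge : ∀ p : (kempeGraph ends c S α β).neighborSet z,
      ∃ e, (e ∈ S ∧ (c e = α ∨ c e = β)) ∧ ends e = s(z, p) := fun p => p.2.1
  choose edge hedge hends using hedge
  have hz : ∀ p, z ∈ ends (edge p) := fun p => hends p ▸ Sym2.mem_mk_left z p
  refine Function.Embedding.encard_le
    ⟨fun p => ⟨c (edge p), hA _ (hedge p).1 (hz p) (hedge p).2⟩, fun p q hpq => ?_⟩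
  have heq : edge p = edge q :=
    hc.eq (hedge p).1 (hedge q).1 (hz p) (hz q) (congrArg Subtype.val hpq)
  exact Subtype.ext (Sym2.congr_right.1 ((hends p).symm.trans (heq ▸ hends q)))

theorem IsProperOn.eq_of_missing (hc : IsProperOn ends c S) (hloop : ∀ e, ¬ (ends e).IsDiag)
    (hno : ¬ ∃ c' : E → C, IsProperOn ends c' (insert x S)) (hxS : x ∉ S)
    (hx : ends x = s(w, v)) (hw : Missing ends c S w α) (hu : u ∈ fanEnds ends c S w v)
    (hu' : u' ∈ fanEnds ends c S w v) (ha : Missing ends c S u β)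
    (ha' : Missing ends c S u' β) : u = u' := by
  obtain ⟨l, hl, hF⟩ := hu
  obtain ⟨l', hl', hF'⟩ := hu'
  have hvw : v ≠ w := fun h => hloop x (by simp [hx, h])
  have hsingle : ∀ {z a}, (∀ e ∈ S, z ∈ ends e → c e = α ∨ c e = β → c e ∈ ({a} : Set C)) →
      ((kempeGraph ends c S α β).neighborSet z).Subsingleton := fun h =>
    encard_le_one_iff_subsingleton.1
      ((hc.encard_neighborSet_kempeGraph_le h).trans (encard_singleton _).le)
  have hpair : ({α, β} : Set C).encard ≤ 2 :=
    (encard_insert_le {β} α).trans_eq (by rw [encard_singleton, one_add_one_eq_two])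
  refine eq_of_reachable_of_subsingleton_neighborSet
    (fun z => (hc.encard_neighborSet_kempeGraph_le fun e _ _ h => h).trans hpair)
    (hsingle (a := β) fun e he hz h => h.resolve_left (hw e he hz))
    (hsingle (a := α) fun e he hz h => h.resolve_right (ha e he hz))
    (hsingle (a := α) fun e he hz h => h.resolve_right (ha' e he hz))
    (hF.reachable_kempeGraph hno hc hxS hx hl hw ha)
    (hF'.reachable_kempeGraph hno hc hxS hx hl' hw ha')
    (hF.ne hloop hvw).symm (hF'.ne hloop hvw).symm

theorem finite_fanEnds (hS : S.Finite) : (fanEnds ends c S w v).Finite := by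
  classical
  refine ((hS.biUnion fun e _ => (ends e).toFinset.finite_toSet).insert v).subset ?_
  rintro u ⟨l, -, hF⟩
  rcases List.eq_nil_or_concat l with rfl | ⟨l, g, rfl⟩
  · exact Or.inl hF.symm
  · obtain ⟨m, -, hg, hgu, -⟩ := fan_append_singleton.1 (List.concat_eq_append ▸ hF)
    exact Or.inr (mem_biUnion hg (by simp [hgu]))

theorem exists_mem_fanEnds (hu : u ∈ fanEnds ends c S w v) (ha : Missing ends c S u a)
    (hw : ¬ Missing ends c S w a) :
    ∃ u' ∈ fanEnds ends c S w v, ∃ g ∈ S, ends g = s(w, u') ∧ c g = a := by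
  obtain ⟨l, hl, hF⟩ := hu
  simp only [Missing, not_forall, not_not] at hw
  obtain ⟨g, hg, hwg, rfl⟩ := hw
  obtain ⟨u', hu'⟩ := Sym2.mem_iff_exists.1 hwg
  refine ⟨u', ?_, g, hg, hu', rfl⟩
  by_cases hgl : g ∈ l
  · obtain ⟨l₁, l₂, rfl⟩ := List.append_of_mem hgl
    obtain ⟨m, hF₁, _, -, -, hm, -⟩ := fan_append.1 hF
    exact ⟨l₁ ++ [g], hl.sublist (List.Sublist.append_left (by simp) _),
      fan_append_singleton.2 ⟨m, hF₁, hg, hu', hm⟩⟩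
  · exact ⟨l ++ [g], by simpa [List.nodup_append] using ⟨hl, fun e he h => hgl (h ▸ he)⟩,
      fan_append_singleton.2 ⟨u, hF, hg, hu', ha⟩⟩

theorem le_ncard_missing [Finite E] [Finite C] {D μ : ℕ} (hC : D + μ ≤ Nat.card C)
    (hdeg : {e | u ∈ ends e}.ncard ≤ D) : μ ≤ {a | Missing ends c S u a}.ncard := by
  have hcompl : {a | Missing ends c S u a}ᶜ ⊆ c '' {e | u ∈ ends e} := fun a ha => by
    simp only [mem_compl_iff, mem_ofPred_eq, Missing, not_forall, not_not] at ha
    obtain ⟨e, -, hue, rfl⟩ := ha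
    exact ⟨e, hue, rfl⟩
  have hle := (ncard_le_ncard hcompl).trans ((ncard_image_le (toFinite _)).trans hdeg)
  have hsum := ncard_add_ncard_compl {a | Missing ends c S u a}
  omega

theorem sum_ncard_le_sum_ncard_of_subset_image {ι A B : Type*} [Finite A] [Finite B]
    {U : Finset ι} {M : ι → Set A} {N : ι → Set B} (f : B → A)
    (hM : (U : Set ι).PairwiseDisjoint M) (hMN : ∀ i ∈ U, M i ⊆ f '' ⋃ j ∈ U, N j) :
    ∑ i ∈ U, (M i).ncard ≤ ∑ i ∈ U, (N i).ncard := calc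
  ∑ i ∈ U, (M i).ncard = (⋃ i ∈ U, M i).ncard := by
    rw [← finsum_mem_coe_finset]
    exact (U.finite_toSet.ncard_biUnion (fun _ _ => toFinite _) hM).symm
  _ ≤ (f '' ⋃ i ∈ U, N i).ncard := ncard_le_ncard (iUnion₂_subset hMN)
  _ ≤ (⋃ i ∈ U, N i).ncard := ncard_image_le
  _ ≤ ∑ i ∈ U, (N i).ncard := U.set_ncard_biUnion_le N

theorem IsProperOn.exists_insert [Finite E] [Finite C] (hc : IsProperOn ends c S)
    (hloop : ∀ e, ¬ (ends e).IsDiag) {D μ : ℕ} (hC : D + μ ≤ Nat.card C)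
    (hdeg : ∀ v, {e | v ∈ ends e}.ncard ≤ D) (hmul : ∀ u v, {e | ends e = s(u, v)}.ncard ≤ μ)
    (hxS : x ∉ S) : ∃ c' : E → C, IsProperOn ends c' (insert x S) := by
  by_contra hno
  obtain ⟨w, v, hx⟩ : ∃ w v, ends x = s(w, v) := (ends x).ind fun w v => ⟨w, v, rfl⟩
  have hmiss : ∀ u, μ ≤ {a | Missing ends c S u a}.ncard := fun u => le_ncard_missing hC (hdeg u)
  have hpar : ∀ u, {e ∈ S | ends e = s(w, u)}.ncard ≤ μ := fun u =>
    (ncard_le_ncard fun e he => he.2).trans (hmul w u)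
  have hparv : {e ∈ S | ends e = s(w, v)}.ncard < μ :=
    (ncard_lt_ncard ⟨fun e he => he.2, fun h => hxS (h hx).1⟩).trans_le (hmul w v)
  obtain ⟨α, hα⟩ : {a | Missing ends c S w a}.Nonempty :=
    nonempty_of_ncard_ne_zero (by have := hmiss w; omega)
  have hfin : (fanEnds ends c S w v).Finite := finite_fanEnds S.toFinite
  have hv : v ∈ hfin.toFinset := hfin.mem_toFinset.2 ⟨[], List.nodup_nil, rfl⟩
  have hdisj : (hfin.toFinset : Set V).PairwiseDisjoint fun u => {a | Missing ends c S u a} := by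
    intro u hu u' hu' hne
    rw [hfin.coe_toFinset] at hu hu'
    exact disjoint_left.2 fun a ha ha' =>
      hne (hc.eq_of_missing hloop hno hxS hx hα hu hu' ha ha')
  have hstep : ∀ u ∈ hfin.toFinset, {a | Missing ends c S u a} ⊆
      c '' ⋃ u' ∈ hfin.toFinset, {e ∈ S | ends e = s(w, u')} := fun u hu a ha => by
    rw [hfin.mem_toFinset] at hu
    have hwa : ¬ Missing ends c S w a := fun hwa => by
      obtain ⟨l, hl, hF⟩ := hu
      exact hno (hF.exists_isProperOn_insert hc hxS hx hl hwa ha)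
    obtain ⟨u', hu', g, hg, hgu', hga⟩ := exists_mem_fanEnds hu ha hwa
    exact ⟨g, mem_biUnion (hfin.mem_toFinset.2 hu') ⟨hg, hgu'⟩, hga⟩
  refine (sum_ncard_le_sum_ncard_of_subset_image c hdisj hstep).not_gt ?_
  exact Finset.sum_lt_sum (fun u _ => (hpar u).trans (hmiss u)) ⟨v, hv, hparv.trans_le (hmiss v)⟩

theorem vizing [Finite E] [Finite C] (hloop : ∀ e, ¬ (ends e).IsDiag) {D μ : ℕ}
    (hC : D + μ ≤ Nat.card C) (hdeg : ∀ v, {e | v ∈ ends e}.ncard ≤ D)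
    (hmul : ∀ u v, {e | ends e = s(u, v)}.ncard ≤ μ) :
    ∃ c : E → C, IsProperOn ends c univ := by
  rcases isEmpty_or_nonempty E with hE | ⟨⟨x⟩⟩
  · exact ⟨isEmptyElim, fun e => isEmptyElim e⟩
  obtain ⟨v, hv⟩ : ∃ v, v ∈ ends x := ⟨_, Sym2.out_fst_mem _⟩
  have hD : 0 < D := ((ncard_pos).2 ⟨x, hv⟩).trans_le (hdeg v)
  obtain ⟨a⟩ : Nonempty C := (Nat.card_pos_iff.1 (by omega)).1
  induction (univ : Set E), (univ : Set E).toFinite using Set.Finite.induction_on with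
  | empty => exact ⟨fun _ => a, pairwise_empty _⟩
  | insert hxS _ ih =>
    obtain ⟨c, hc⟩ := ih
    exact hc.exists_insert hloop hC hdeg hmul hxS

end EdgeColoring

section BlockColoring

variable {α W : Type*}

-- The pairs `inr (w, b)` are dummy elements which complete `F` to a two-element set.
theorem exists_sym2_of_encard_le_two {F : Set α} (hF : F.encard ≤ 2) (w : W) :
    ∃ s : Sym2 (α ⊕ W × Bool), ¬ s.IsDiag ∧ (∀ a, .inl a ∈ s ↔ a ∈ F) ∧
      ∀ j b, .inr (j, b) ∈ s → j = w := by
  rcases hF.lt_or_eq with hF | hF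
  · rcases encard_le_one_iff_eq.1 (ENat.lt_two_iff.1 hF) with rfl | ⟨a, rfl⟩
    · exact ⟨s(.inr (w, false), .inr (w, true)), by simp, by simp, by grind⟩
    · exact ⟨s(.inl a, .inr (w, false)), by simp, by simp, by grind⟩
  · obtain ⟨a, b, hab, rfl⟩ := encard_eq_two.1 hF
    exact ⟨s(.inl a, .inl b), by simpa using hab, by simp, by simp⟩

-- Points become edges of the multigraph whose vertices are the blocks.
theorem exists_coloring_injOn_blocks [Finite W] {M : α → Set W} {D μ : ℕ} (hμ : 1 ≤ μ)
    (hM : ∀ w, {a | w ∈ M a}.encard ≤ 2) (hcard : ∀ a, (M a).ncard ≤ D)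
    (hinter : ∀ a b, a ≠ b → (M a ∩ M b).ncard ≤ μ) :
    ∃ c : W → Fin (D + μ), ∀ a, InjOn c (M a) := by
  rcases D.eq_zero_or_pos with rfl | hD
  · refine ⟨fun _ => ⟨0, by omega⟩, fun a => ?_⟩
    rw [(ncard_eq_zero).1 (Nat.le_zero.1 (hcard a))]
    exact injOn_empty _
  choose ends hloop hblock hdummy using fun w => exists_sym2_of_encard_le_two (hM w) w
  have hone : ∀ (j : W) (q : Set W), (∀ w ∈ q, j = w) → q.ncard ≤ 1 := fun j q hq =>
    (ncard_le_one (toFinite q)).2 fun w hw w' hw' => (hq w hw).symm.trans (hq w' hw')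
  have hdeg : ∀ v, {w | v ∈ ends w}.ncard ≤ D := by
    rintro (a | ⟨j, b⟩)
    · simpa only [hblock, mem_ofPred_eq, ofPred_mem_eq] using hcard a
    · exact (hone j _ fun w hw => hdummy w j b hw).trans hD
  have hmul : ∀ p q, {w | ends w = s(p, q)}.ncard ≤ μ := by
    intro p q
    have hinr : ∀ j b, .inr (j, b) ∈ s(p, q) → {w | ends w = s(p, q)}.ncard ≤ μ := fun j b hj =>
      (hone j _ fun w (hw : ends w = _) => hdummy w j b (hw ▸ hj)).trans hμ
    rcases p with a | ⟨j, b⟩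
    · rcases q with b | ⟨j, b⟩
      · rcases eq_or_ne a b with rfl | hab
        · have hempty : {w | ends w = s(.inl a, .inl a)} = ∅ :=
            eq_empty_of_forall_notMem fun w hw => hloop w (hw ▸ Sym2.diag_isDiag _)
          simp [hempty]
        · refine (ncard_le_ncard fun w (hw : ends w = _) => ?_).trans (hinter a b hab)
          exact ⟨(hblock w a).1 (hw ▸ Sym2.mem_mk_left _ _),
            (hblock w b).1 (hw ▸ Sym2.mem_mk_right _ _)⟩
      · exact hinr j b (Sym2.mem_mk_right _ _)
    · exact hinr j b (Sym2.mem_mk_left _ _)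
  obtain ⟨c, hc⟩ := EdgeColoring.vizing hloop (Nat.card_fin (D + μ)).ge hdeg hmul
  exact ⟨c, fun a w hw w' hw' heq => hc.eq (mem_univ w) (mem_univ w')
    ((hblock w a).2 hw) ((hblock w' a).2 hw') heq⟩

end BlockColoring

/-! ### Faces of plane graphs -/

theorem subset_connectedComponentIn_of_mem_closure {X : Type*} [TopologicalSpace X] {O S : Set X}
    (hS : IsPreconnected S) (hSO : S ⊆ O) {p : X} (hpO : p ∈ O) (hp : p ∈ closure S) :
    S ⊆ connectedComponentIn O p :=
  have hpre : IsPreconnected (insert p S) :=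
    hS.subset_closure (subset_insert _ _) (insert_subset hp subset_closure)
  (subset_insert _ _).trans
    (hpre.subset_connectedComponentIn (mem_insert _ _) (insert_subset hpO hSO))

namespace IsArc

variable {x y : Plane} {A : Set Plane}

theorem isCompact (h : IsArc x y A) : IsCompact A := by
  obtain ⟨γ, hγ, -, -, -, rfl⟩ := h
  exact isCompact_range hγ

theorem isPreconnected (h : IsArc x y A) : IsPreconnected A := by
  obtain ⟨γ, hγ, -, -, -, rfl⟩ := h
  exact isPreconnected_range hγ

theorem ne (h : IsArc x y A) : x ≠ y := by
  obtain ⟨γ, -, hinj, rfl, rfl, -⟩ := h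
  exact hinj.ne zero_ne_one

theorem left_mem (h : IsArc x y A) : x ∈ A := by
  obtain ⟨γ, -, -, rfl, -, rfl⟩ := h
  exact mem_range_self _

theorem right_mem (h : IsArc x y A) : y ∈ A := by
  obtain ⟨γ, -, -, -, rfl, rfl⟩ := h
  exact mem_range_self _

end IsArc

namespace PlaneGraph

variable {G : PlaneGraph} {e f f' : Set Plane} {E E' : Set (Set Plane)} {a b p : Plane}

/-- The part of the drawing that consists of all vertices and the edges in `E`. -/
def drawing (G : PlaneGraph) (E : Set (Set Plane)) : Set Plane := G.verts ∪ ⋃₀ E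

theorem isCompact_edge (he : e ∈ G.edges) : IsCompact e := by
  obtain ⟨x, -, y, -, h, -⟩ := G.isArc_of_mem e he
  exact h.isCompact

theorem isPreconnected_edge (he : e ∈ G.edges) : IsPreconnected e := by
  obtain ⟨x, -, y, -, h, -⟩ := G.isArc_of_mem e he
  exact h.isPreconnected

theorem exists_inter_verts_eq (he : e ∈ G.edges) :
    ∃ x ∈ G.verts, ∃ y ∈ G.verts, x ≠ y ∧ e ∩ G.verts = {x, y} := by
  obtain ⟨x, hx, y, hy, h, hxy⟩ := G.isArc_of_mem e he
  exact ⟨x, hx, y, hy, h.ne, hxy⟩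

theorem exists_sym2_mem_iff (he : e ∈ G.edges) :
    ∃ d : Sym2 G.verts, ∀ v, v ∈ d ↔ (v : Plane) ∈ e := by
  obtain ⟨x, hx, y, hy, -, hxy⟩ := exists_inter_verts_eq he
  refine ⟨s(⟨x, hx⟩, ⟨y, hy⟩), fun v => ?_⟩
  simpa [Subtype.ext_iff] using (Set.ext_iff.1 hxy v).symm

theorem isCompact_drawing (hE : E ⊆ G.edges) : IsCompact (G.drawing E) :=
  G.finite_verts.isCompact.union
    ((G.finite_edges.subset hE).isCompact_sUnion fun _ he => isCompact_edge (hE he))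

theorem isCompact_support : IsCompact G.support := isCompact_drawing Subset.rfl

theorem drawing_mono (h : E ⊆ E') : G.drawing E ⊆ G.drawing E' :=
  union_subset_union_right _ (sUnion_subset_sUnion h)

theorem drawing_union (E E' : Set (Set Plane)) :
    G.drawing E ∪ G.drawing E' = G.drawing (E ∪ E') := by
  rw [drawing, drawing, drawing, sUnion_union, ← union_union_distrib_left]

theorem drawing_inter (hE : E ⊆ G.edges) (hE' : E' ⊆ G.edges) :
    G.drawing E ∩ G.drawing E' = G.drawing (E ∩ E') := by
  refine Subset.antisymm ?_ (subset_inter (drawing_mono inter_subset_left)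
    (drawing_mono inter_subset_right))
  rw [drawing, drawing, ← union_inter_distrib_left]
  refine union_subset subset_union_left ?_
  rintro z ⟨⟨g, hg, hz⟩, g', hg', hz'⟩
  by_cases hgg' : g = g'
  · exact Or.inr ⟨g, ⟨hg, hgg' ▸ hg'⟩, hz⟩
  · exact Or.inl (G.inter_subset g (hE hg) g' (hE' hg') hgg' ⟨hz, hz'⟩)

theorem drawing_diff_singleton_union (he : e ∈ G.edges) :
    G.drawing (G.edges \ {e}) ∪ e = G.support := by
  rw [drawing, union_assoc, ← sUnion_singleton (s := e), ← sUnion_union, sUnion_singleton,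
    sdiff_union_of_subset (singleton_subset_iff.2 he), support]

theorem drawing_diff_singleton_inter (he : e ∈ G.edges) :
    G.drawing (G.edges \ {e}) ∩ e = e ∩ G.verts := by
  refine Subset.antisymm ?_ fun z hz => ⟨Or.inl hz.2, hz.1⟩
  rintro z ⟨h | ⟨g, hg, h⟩, hz⟩
  · exact ⟨hz, h⟩
  · exact ⟨hz, G.inter_subset g hg.1 e he hg.2 ⟨h, hz⟩⟩

theorem eq_connectedComponentIn (hf : f ∈ G.faces) (ha : a ∈ f) :
    f = connectedComponentIn G.supportᶜ a := by
  obtain ⟨x, -, rfl⟩ := hf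
  exact connectedComponentIn_eq ha

theorem nonempty_face (hf : f ∈ G.faces) : f.Nonempty := by
  obtain ⟨x, hx, rfl⟩ := hf
  exact ⟨x, mem_connectedComponentIn hx⟩

theorem face_subset (hf : f ∈ G.faces) : f ⊆ G.supportᶜ := by
  obtain ⟨x, -, rfl⟩ := hf
  exact connectedComponentIn_subset _ _

theorem isPreconnected_face (hf : f ∈ G.faces) : IsPreconnected f := by
  obtain ⟨x, -, rfl⟩ := hf
  exact isPreconnected_connectedComponentIn

theorem isOpen_face (hf : f ∈ G.faces) : IsOpen f := by
  obtain ⟨x, -, rfl⟩ := hf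
  exact isCompact_support.isClosed.isOpen_compl.connectedComponentIn

theorem frontier_face_subset (hf : f ∈ G.faces) : frontier f ⊆ G.support := by
  obtain ⟨x, -, rfl⟩ := hf
  simpa using frontier_connectedComponentIn_subset isCompact_support.isClosed.isOpen_compl x

theorem eq_of_hasLogOn_quot (hf : f ∈ G.faces) (hf' : f' ∈ G.faces) (ha : a ∈ f) (hb : b ∈ f')
    (h : HasLogOn (quot a b) G.support) : f = f' := by
  rw [eq_connectedComponentIn hf ha, eq_connectedComponentIn hf' hb]
  exact connectedComponentIn_eq (mem_connectedComponentIn_of_hasLogOn_quot isCompact_support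
    (face_subset hf ha) (face_subset hf' hb) h)

theorem hasLogOn_quot_edge (he : e ∈ G.edges) (ha : a ∉ G.support) (hb : b ∉ G.support) :
    HasLogOn (quot a b) e := by
  have hsub : e ⊆ G.support := fun z hz => Or.inr ⟨e, he, hz⟩
  obtain ⟨x, -, y, -, ⟨γ, hγ, hinj, -, -, hγe⟩, -⟩ := G.isArc_of_mem e he
  have himage : γ '' Icc 0 1 = e := by
    rw [← hγe, ← image_univ, ← Set.Icc_bot_top]
    rfl
  rw [← himage] at hsub ⊢
  exact .image_Icc hγ hinj zero_le_one (continuousOn_quot a fun h => hb (hsub h)) fun z hz =>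
    quot_ne_zero (ne_of_mem_of_not_mem (hsub hz) ha) (ne_of_mem_of_not_mem (hsub hz) hb)

/-- Both faces lie in the component of `p` in the complement of the drawing without `e`. -/
theorem hasLogOn_quot_of_mem_frontier (he : e ∈ G.edges) (hf : f ∈ G.faces) (hf' : f' ∈ G.faces)
    (hp : p ∈ e \ G.verts) (hpf : p ∈ frontier f) (hpf' : p ∈ frontier f') (ha : a ∈ f)
    (hb : b ∈ f') : HasLogOn (quot a b) (G.drawing (G.edges \ {e})) := by
  have hpD : p ∈ (G.drawing (G.edges \ {e}))ᶜ := fun hpD =>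
    hp.2 ((drawing_diff_singleton_inter he).subset ⟨hpD, hp.1⟩).2
  have hsub : ∀ g ∈ G.faces, p ∈ frontier g →
      g ⊆ connectedComponentIn (G.drawing (G.edges \ {e}))ᶜ p := fun g hg hpg =>
    subset_connectedComponentIn_of_mem_closure (isPreconnected_face hg)
      ((face_subset hg).trans (compl_subset_compl.2 (drawing_mono sdiff_subset))) hpD
      (frontier_subset_closure hpg)
  exact hasLogOn_quot_of_isPreconnected (isCompact_drawing sdiff_subset).isClosed
    isPreconnected_connectedComponentIn (connectedComponentIn_subset _ _) (hsub f hf hpf ha)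
    (hsub f' hf' hpf' hb)

theorem not_injective_of_mem_frontier (he : e ∈ G.edges) (hp : p ∈ e \ G.verts)
    {f : Fin 3 → Set Plane} (hf : ∀ i, f i ∈ G.faces) (hpf : ∀ i, p ∈ frontier (f i)) :
    ¬ Function.Injective f := by
  intro hinj
  choose a ha using fun i => nonempty_face (hf i)
  have haK : ∀ i, a i ∉ G.support := fun i => face_subset (hf i) (ha i)
  have hsep : ∀ i j, i ≠ j → a j ∉ connectedComponentIn G.supportᶜ (a i) := by
    intro i j hij haj
    rw [← eq_connectedComponentIn (hf i) (ha i)] at haj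
    refine hij (hinj ?_)
    rw [eq_connectedComponentIn (hf i) haj, eq_connectedComponentIn (hf j) (ha j)]
  have hD : ∀ i j, HasLogOn (quot (a i) (a j)) (G.drawing (G.edges \ {e})) := fun i j =>
    hasLogOn_quot_of_mem_frontier he (hf i) (hf j) hp (hpf i) (hpf j) (ha i) (ha j)
  have he' : ∀ i j, HasLogOn (quot (a i) (a j)) e := fun i j =>
    hasLogOn_quot_edge he (haK i) (haK j)
  obtain ⟨x, -, y, -, -, hxy⟩ := exists_inter_verts_eq he
  obtain ⟨k, l, hkl, hlog⟩ := HasLogOn.exists_zpow_mul_zpow_union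
    (isCompact_drawing sdiff_subset).isClosed (isCompact_edge he).isClosed
    ((drawing_diff_singleton_inter he).trans hxy) (hD 0 2) (he' 0 2) (hD 1 2) (he' 1 2)
  rw [drawing_diff_singleton_union he] at hlog
  have hzero := eq_zero_of_hasLogOn_prod isCompact_support haK hsep (k := ![k, l, -(k + l)])
    (by simp [Fin.sum_univ_three]) (hlog.congr fun z hz => by
      have h2 : coord (z - a 2) ≠ 0 := coord_sub_ne_zero.2 (ne_of_mem_of_not_mem hz (haK 2))
      simp only [quot, div_zpow, Fin.prod_univ_three, Matrix.cons_val, zpow_neg, zpow_add₀ h2]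
      field_simp)
  exact hkl.elim (fun hk => hk (hzero 0)) fun hl => hl (hzero 1)

theorem encard_faces_le_two (he : e ∈ G.edges) (hp : p ∈ e \ G.verts) :
    {f ∈ G.faces | p ∈ frontier f}.encard ≤ 2 := by
  by_contra! h
  obtain ⟨t, ht, ht3⟩ := exists_subset_encard_eq (Order.add_one_le_of_lt h)
  obtain ⟨f₁, f₂, f₃, h₁₂, h₁₃, h₂₃, rfl⟩ := encard_eq_three.1 (ht3.trans (by norm_num))
  have hmem : ∀ i, ![f₁, f₂, f₃] i ∈ {f ∈ G.faces | p ∈ frontier f} := fun i =>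
    ht (by fin_cases i <;> simp)
  refine not_injective_of_mem_frontier he hp (fun i => (hmem i).1) (fun i => (hmem i).2) ?_
  intro i j hij
  fin_cases i <;> fin_cases j <;> simp_all

/-- The stars of the vertices are connected, and stars of adjacent vertices meet. -/
theorem isPreconnected_drawing (hE : E ⊆ G.edges) {H : SimpleGraph G.verts} (hH : H.Preconnected)
    (hadj : ∀ u v, H.Adj u v → ∃ g ∈ E, (u : Plane) ∈ g ∧ (v : Plane) ∈ g) :
    IsPreconnected (G.drawing E) := by
  let star : G.verts → Set Plane := fun v => ⋃₀ insert {(v : Plane)} {g ∈ E | (v : Plane) ∈ g}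
  have hmem : ∀ v, (v : Plane) ∈ star v := fun v => ⟨_, mem_insert _ _, rfl⟩
  have hstar : ∀ v, IsPreconnected (star v) := fun v => by
    refine isPreconnected_sUnion (v : Plane) _ ?_ ?_ <;> rw [forall_mem_insert]
    · exact ⟨rfl, fun g hg => hg.2⟩
    · exact ⟨isPreconnected_singleton, fun g hg => isPreconnected_edge (hE hg.1)⟩
  have hmeet : ∀ u v, Relation.ReflTransGen (fun u v => (star u ∩ star v).Nonempty) u v :=
    fun u v => by
      refine ((SimpleGraph.reachable_iff_reflTransGen u v).1 (hH u v)).lift id fun u v huv => ?_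
      obtain ⟨g, hg, hu, hv⟩ := hadj u v huv
      exact ⟨v, ⟨g, mem_insert_of_mem _ ⟨hg, hu⟩, hv⟩, hmem v⟩
  have hunion : G.drawing E = ⋃ v, star v := by
    refine Subset.antisymm (union_subset (fun v hv => mem_iUnion.2 ⟨⟨v, hv⟩, hmem _⟩) ?_)
      (iUnion_subset fun v => sUnion_subset (forall_mem_insert.2 ⟨?_, ?_⟩))
    · intro z ⟨g, hg, hz⟩
      obtain ⟨x, hx, y, -, -, hxy⟩ := exists_inter_verts_eq (hE hg)
      have hxg : x ∈ g := (hxy.symm.subset (mem_insert x _)).1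
      exact mem_iUnion.2 ⟨⟨x, hx⟩, g, mem_insert_of_mem _ ⟨hg, hxg⟩, hz⟩
    · exact singleton_subset_iff.2 (Or.inl v.2)
    · exact fun g hg z hz => Or.inr ⟨g, hg.1, hz⟩
  rw [hunion]
  exact .iUnion_of_reflTransGen hstar hmeet

theorem IsThreeConnected.isEdgeConnected (hG : G.IsThreeConnected) :
    G.graph.IsEdgeConnected 3 := by
  refine isEdgeConnected_of_induce_preconnected ?_ fun S hS => (hG.2 S ?_).preconnected
  · have h4 : ((4 : ℕ) : ℕ∞) ≤ G.verts.encard :=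
      (Nat.cast_le.2 hG.1).trans (ncard_le_encard _)
    exact lt_of_lt_of_le (by norm_num) h4
  · exact (encard_le_coe_iff_finite_ncard_le.1 (Order.le_of_lt_add_one hS)).2

theorem IsThreeConnected.isPreconnected_drawing (hG : G.IsThreeConnected)
    (hE : E.encard < 3) : IsPreconnected (G.drawing (G.edges \ E)) := by
  have : Nonempty G.verts := (nonempty_of_ncard_ne_zero (by have := hG.1; omega)).to_subtype
  have : Nonempty (Sym2 G.verts) := this.map Sym2.diag
  choose! d hd using fun e (he : e ∈ G.edges) => exists_sym2_mem_iff he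
  have hF : (d '' E).encard < 3 := (encard_image_le d E).trans_lt hE
  refine PlaneGraph.isPreconnected_drawing sdiff_subset
    (fun u v => hG.isEdgeConnected u v hF) fun u v huv => ?_
  obtain ⟨⟨huv, g, hg, hu, hv⟩, hF⟩ := SimpleGraph.deleteEdges_adj.1 huv
  refine ⟨g, ⟨hg, fun hgE => hF ⟨g, hgE, ?_⟩⟩, hu, hv⟩
  exact (Sym2.mem_and_mem_iff huv).1 ⟨(hd g hg u).2 hu, (hd g hg v).2 hv⟩

theorem IsThreeConnected.edge_eq_of_mem_frontier (hG : G.IsThreeConnected) {e' : Set Plane}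
    (he : e ∈ G.edges) (he' : e' ∈ G.edges) (hf : f ∈ G.faces) (hf' : f' ∈ G.faces)
    (hff' : f ≠ f') {p p' : Plane} (hp : p ∈ e \ G.verts) (hp' : p' ∈ e' \ G.verts)
    (hpf : p ∈ frontier f) (hpf' : p ∈ frontier f') (hp'f : p' ∈ frontier f)
    (hp'f' : p' ∈ frontier f') : e = e' := by
  by_contra hee'
  obtain ⟨a, ha⟩ := nonempty_face hf
  obtain ⟨b, hb⟩ := nonempty_face hf'
  have hinter : G.drawing (G.edges \ {e}) ∩ G.drawing (G.edges \ {e'}) =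
      G.drawing (G.edges \ {e, e'}) := by
    rw [drawing_inter sdiff_subset sdiff_subset, sdiff_inter_sdiff, singleton_union]
  have hunion : G.drawing (G.edges \ {e}) ∪ G.drawing (G.edges \ {e'}) = G.support := by
    rw [drawing_union, ← sdiff_inter, singleton_inter_eq_empty.2 (by simpa using hee'),
      sdiff_empty, drawing, support]
  have hlog := HasLogOn.union
      (isCompact_drawing (G := G) (E := G.edges \ {e}) sdiff_subset).isClosed
    (isCompact_drawing (G := G) (E := G.edges \ {e'}) sdiff_subset).isClosed
    (hasLogOn_quot_of_mem_frontier he hf hf' hp hpf hpf' ha hb)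
    (hasLogOn_quot_of_mem_frontier he' hf hf' hp' hp'f hp'f' ha hb)
    (hinter ▸ hG.isPreconnected_drawing
      ((encard_pair hee').trans_lt (by norm_num)))
  rw [hunion] at hlog
  exact hff' (eq_of_hasLogOn_quot hf hf' ha hb hlog)

/-- `L` is the shortest subarc of `e` that contains `e ∩ F`. -/
theorem exists_isClosed_hull (he : e ∈ G.edges) {F : Set Plane} (hF : IsClosed F) :
    ∃ L ⊆ e, IsClosed L ∧ e ∩ F ⊆ L ∧ L ∩ G.verts ⊆ F ∧
      ∀ g : Plane → ℂ, ContinuousOn g L → (∀ z ∈ L, g z ≠ 0) → HasLogOn g L := by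
  obtain ⟨x, -, y, -, ⟨γ, hγ, hinj, rfl, rfl, rfl⟩, hV⟩ := G.isArc_of_mem e he
  obtain hempty | hne := (γ ⁻¹' F).eq_empty_or_nonempty
  · refine ⟨∅, empty_subset _, isClosed_empty, ?_, by simp, fun g _ _ =>
      .of_finite finite_empty (by simp)⟩
    rintro _ ⟨⟨r, rfl⟩, hr⟩
    exact (hempty.subset hr).elim
  have hcomp : IsCompact (γ ⁻¹' F) := (hF.preimage hγ).isCompact
  obtain ⟨s, hs⟩ := hcomp.exists_isLeast hne
  obtain ⟨t, ht⟩ := hcomp.exists_isGreatest hne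
  refine ⟨γ '' Icc s t, image_subset_range _ _, (isCompact_Icc.image hγ).isClosed, ?_, ?_,
    fun g => .image_Icc hγ hinj (hs.2 ht.1)⟩
  · rintro _ ⟨⟨r, rfl⟩, hr⟩
    exact ⟨r, ⟨hs.2 hr, ht.2 hr⟩, rfl⟩
  · rintro _ ⟨⟨r, hr, rfl⟩, hrV⟩
    rcases hV.subset ⟨mem_range_self r, hrV⟩ with h | h
    · have hsr : s = r := le_antisymm hr.1 (hinj h ▸ unitInterval.nonneg')
      exact hsr ▸ hs.1
    · have htr : t = r := le_antisymm (hinj h ▸ unitInterval.le_one') hr.2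
      exact htr ▸ ht.1

theorem inter_verts_eq_pair (he : e ∈ G.edges) {x y : Plane} (hx : x ∈ e ∩ G.verts)
    (hy : y ∈ e ∩ G.verts) (hxy : x ≠ y) : e ∩ G.verts = {x, y} := by
  obtain ⟨u, -, v, -, huv, he⟩ := exists_inter_verts_eq he
  rw [he] at hx hy ⊢
  refine (eq_of_subset_of_ncard_le (insert_subset hx (singleton_subset_iff.2 hy)) ?_).symm
  rw [ncard_pair huv, ncard_pair hxy]

theorem IsSimple.subsingleton_inter (hG : G.IsSimple) {e' : Set Plane} (he : e ∈ G.edges)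
    (he' : e' ∈ G.edges) (hne : e ≠ e') : (e ∩ e').Subsingleton := by
  intro x hx y hy
  by_contra hxy
  have hxV := G.inter_subset e he e' he' hne hx
  have hyV := G.inter_subset e he e' he' hne hy
  exact hne (hG e he e' he' ((inter_verts_eq_pair he ⟨hx.1, hxV⟩ ⟨hy.1, hyV⟩ hxy).trans
    (inter_verts_eq_pair he' ⟨hx.2, hxV⟩ ⟨hy.2, hyV⟩ hxy).symm))

/-- `N` consists of the subarcs of the edges spanned by `F`. A cycle in `N` would pass through three
vertices. -/
theorem IsSimple.exists_isClosed_hull (hG : G.IsSimple) {F : Set Plane} (hF : IsClosed F)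
    (hFK : F ⊆ G.support) (hF2 : (G.verts ∩ F).ncard ≤ 2) :
    ∃ N ⊆ G.support, IsClosed N ∧ F ⊆ N ∧ N ∩ G.verts ⊆ F ∧
      ∀ a ∉ N, ∀ b ∉ N, HasLogOn (quot a b) N := by
  have hfin : (G.verts ∩ F).Finite := G.finite_verts.subset inter_subset_left
  choose! L hLe hLcl hFL hLF hLlog using fun e (he : e ∈ G.edges) =>
    PlaneGraph.exists_isClosed_hull he hF
  set T := G.finite_edges.toFinset
  have hT : ∀ {e}, e ∈ T ↔ e ∈ G.edges := G.finite_edges.mem_toFinset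
  set N := (G.verts ∩ F) ∪ ⋃ e ∈ T, L e
  have hLN : ∀ e ∈ T, L e ⊆ N := fun e he => (subset_biUnion_of_mem he).trans subset_union_right
  refine ⟨N, ?_, ?_, fun z hz => ?_, ?_, fun a ha b hb => ?_⟩
  · exact union_subset (inter_subset_left.trans subset_union_left)
      (iUnion₂_subset fun e he z hz => Or.inr ⟨e, hT.1 he, hLe e (hT.1 he) hz⟩)
  · exact hfin.isClosed.union (T.finite_toSet.isClosed_biUnion fun e he => hLcl e (hT.1 he))
  · obtain hzV | ⟨e, he, hze⟩ := hFK hz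
    · exact Or.inl ⟨hzV, hz⟩
    · exact hLN e (hT.2 he) (hFL e he ⟨hze, hz⟩)
  · rintro z ⟨hz | hz, hzV⟩
    · exact hz.2
    · obtain ⟨e, he, hze⟩ := mem_iUnion₂.1 hz
      exact hLF e (hT.1 he) ⟨hze, hzV⟩
  have hquot : ∀ z ∈ N, quot a b z ≠ 0 := fun z hz =>
    quot_ne_zero (ne_of_mem_of_not_mem hz ha) (ne_of_mem_of_not_mem hz hb)
  refine .biUnion_of_ncard_le_two T hfin hF2 (fun z hz => hquot z (Or.inl hz))
    (fun e he => hLcl e (hT.1 he)) (fun e he => ?_) (fun e he e' he' hne z hz => ?_)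
    fun e he e' he' hne => (hG.subsingleton_inter (hT.1 he) (hT.1 he') hne).anti
      (inter_subset_inter (hLe e (hT.1 he)) (hLe e' (hT.1 he')))
  · exact hLlog e (hT.1 he) _ (continuousOn_quot a fun h => hb (hLN e he h))
      fun z hz => hquot z (hLN e he hz)
  · have hzV := G.inter_subset e (hT.1 he) e' (hT.1 he') hne
      ⟨hLe e (hT.1 he) hz.1, hLe e' (hT.1 he') hz.2⟩
    exact ⟨hzV, hLF e (hT.1 he) ⟨hz.1, hzV⟩⟩

theorem IsSimple.three_le_faceDegree (hG : G.IsSimple) (h3 : 3 ≤ G.verts.ncard)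
    (hf : f ∈ G.faces) : 3 ≤ G.faceDegree f := by
  by_contra! hlt
  obtain ⟨v, hvV, hv⟩ : ∃ v ∈ G.verts, v ∉ G.faceVerts f :=
    exists_mem_notMem_of_ncard_lt_ncard (hlt.trans_le h3)
      (G.finite_verts.subset inter_subset_left)
  obtain ⟨a, ha⟩ := nonempty_face hf
  obtain ⟨N, hNK, hN, hfN, hNV, hlog⟩ := hG.exists_isClosed_hull (isClosed_frontier (s := f))
    (frontier_face_subset hf) (Nat.le_of_lt_succ hlt)
  have haN : a ∉ N := fun h => face_subset hf ha (hNK h)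
  have hvN : v ∉ N := fun h => hv ⟨hvV, hNV ⟨h, hvV⟩⟩
  have hva : v ∈ connectedComponentIn Nᶜ a := mem_connectedComponentIn_of_hasLogOn_quot
    (isCompact_support.of_isClosed_subset hN hNK) haN hvN (hlog a haN v hvN)
  have hsub : connectedComponentIn Nᶜ a ⊆ f := by
    refine isPreconnected_connectedComponentIn.subset_of_closure_inter_subset (isOpen_face hf)
      ⟨a, mem_connectedComponentIn haN, ha⟩ fun z hz => ?_
    by_contra hzf
    exact connectedComponentIn_subset _ _ hz.2
      (hfN ((isOpen_face hf).frontier_eq ▸ ⟨hz.1, hzf⟩))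
  exact face_subset hf (hsub hva) (Or.inl hvV)

theorem exists_face : ∃ f, f ∈ G.faces := by
  obtain ⟨x, hx⟩ := (ne_univ_iff_exists_notMem _).1 G.isCompact_support.ne_univ
  exact ⟨_, x, hx, rfl⟩

end PlaneGraph

/-! ### Subdivisions -/

namespace PlaneGraph

variable {R G G' : PlaneGraph} {e : Set Plane}

theorem exists_edge_superset_of_isPreconnected {C : Set Plane} (hC : IsPreconnected C)
    (hne : C.Nonempty) (hsub : C ⊆ G.support \ G.verts) : ∃ e ∈ G.edges, C ⊆ e := by
  obtain ⟨x, hx⟩ := hne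
  obtain ⟨e, he, hxe⟩ := (hsub hx).1.resolve_left (hsub hx).2
  have hclosed : IsClosed (⋃₀ (G.edges \ {e})) :=
    ((G.finite_edges.subset sdiff_subset).isCompact_sUnion fun g hg =>
      isCompact_edge hg.1).isClosed
  have hcover : C ⊆ e ∪ ⋃₀ (G.edges \ {e}) := fun z hz => by
    obtain ⟨g, hg, hzg⟩ := (hsub hz).1.resolve_left (hsub hz).2
    by_cases hge : g = e
    · exact Or.inl (hge ▸ hzg)
    · exact Or.inr ⟨g, ⟨hg, hge⟩, hzg⟩
  have hdisj : C ∩ (e ∩ ⋃₀ (G.edges \ {e})) = ∅ := by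
    refine eq_empty_of_forall_notMem ?_
    rintro z ⟨hz, hze, g, ⟨hg, hge⟩, hzg⟩
    exact (hsub hz).2 (G.inter_subset g hg e he hge ⟨hzg, hze⟩)
  rcases isPreconnected_iff_subset_of_disjoint_closed.1 hC e _ (isCompact_edge he).isClosed
    hclosed hcover hdisj with h | h
  · exact ⟨e, he, h⟩
  · exact absurd (hdisj.le ⟨hx, hxe, h hx⟩) (notMem_empty x)

theorem adj_of_forall_Ioo_notMem {γ : unitInterval → Plane} (hγ : Continuous γ)
    (hinj : Function.Injective γ) (hsub : range γ ⊆ G.support) {s t : unitInterval} (hst : s < t)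
    (hs : γ s ∈ G.verts) (ht : γ t ∈ G.verts) (hIoo : ∀ r ∈ Ioo s t, γ r ∉ G.verts) :
    G.graph.Adj ⟨γ s, hs⟩ ⟨γ t, ht⟩ := by
  obtain ⟨e, he, hIe⟩ := exists_edge_superset_of_isPreconnected
    (isPreconnected_Ioo.image γ hγ.continuousOn) ((nonempty_Ioo.2 hst).image γ)
    (image_subset_iff.2 fun r hr => ⟨hsub (mem_range_self r), hIoo r hr⟩)
  have hIcc : Icc s t ⊆ γ ⁻¹' e := closure_Ioo hst.ne ▸
    closure_minimal (image_subset_iff.1 hIe) ((isCompact_edge he).isClosed.preimage hγ)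
  exact ⟨fun h => hst.ne (hinj (congrArg Subtype.val h)), e, he, hIcc (left_mem_Icc.2 hst.le),
    hIcc (right_mem_Icc.2 hst.le)⟩

theorem length_le_longestTwoPath {L : List G.verts} (hchain : L.IsChain G.graph.Adj)
    (hnodup : L.Nodup) (hdeg : ∀ w ∈ L, G.degree w = 2) : L.length ≤ G.longestTwoPath := by
  have := G.finite_verts.fintype
  by_cases hne : L = []
  · simp [hne]
  refine le_csSup ⟨Fintype.card G.verts, ?_⟩ ⟨_, _, .ofSupport L hne hchain, ?_, ?_, ?_⟩
  · rintro n ⟨u, v, p, hp, -, rfl⟩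
    exact hp.support_nodup.length_le_card
  · rwa [SimpleGraph.Walk.isPath_def, SimpleGraph.Walk.support_ofSupport]
  · rwa [SimpleGraph.Walk.support_ofSupport]
  · rw [SimpleGraph.Walk.support_ofSupport]

/-- `G` is obtained from `R` by adding vertices of degree two without changing the drawing. This
is all that is used of a subdivision. -/
structure Refines (R G : PlaneGraph) : Prop where
  support_eq : G.support = R.support
  verts_subset : R.verts ⊆ G.verts
  degree_eq_two : ∀ z ∈ G.verts \ R.verts, G.degree z = 2

theorem Refines.exists_edge_mem (hR : Refines R G) {z : Plane} (hz : z ∈ G.verts \ R.verts) :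
    ∃ e ∈ R.edges, z ∈ e :=
  (hR.support_eq ▸ Or.inl hz.1 : z ∈ R.support).resolve_left hz.2

theorem Refines.ncard_inter_le_longestTwoPath (hR : Refines R G) (he : e ∈ R.edges) :
    ((G.verts \ R.verts) ∩ e).ncard ≤ G.longestTwoPath := by
  obtain ⟨x, -, y, -, ⟨γ, hγ, hinj, rfl, rfl, rfl⟩, hV⟩ := R.isArc_of_mem e he
  have hfin : (γ ⁻¹' (G.verts \ R.verts)).Finite :=
    (G.finite_verts.sdiff).preimage hinj.injOn
  let t := hfin.toFinset.orderEmbOfFin rfl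
  have ht : ∀ i, γ (t i) ∈ G.verts \ R.verts := fun i =>
    hfin.mem_toFinset.1 (Finset.orderEmbOfFin_mem _ rfl i)
  have hR01 : ∀ r, γ r ∈ R.verts → r = 0 ∨ r = 1 := fun r hr => by
    have : γ r ∈ range γ ∩ R.verts := ⟨mem_range_self r, hr⟩
    rw [hV] at this
    exact this.imp (hinj ·) (hinj ·)
  have hgap : ∀ i j : Fin _, j.1 = i.1 + 1 → ∀ r ∈ Ioo (t i) (t j), γ r ∉ G.verts := by
    intro i j hij r hr hrG
    have hrR : γ r ∉ R.verts := fun h => by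
      rcases hR01 r h with rfl | rfl
      · exact not_lt_bot hr.1
      · exact not_top_lt hr.2
    obtain ⟨k, rfl⟩ : r ∈ range t := by
      rw [Finset.range_orderEmbOfFin]
      exact hfin.mem_toFinset.2 ⟨hrG, hrR⟩
    have := t.lt_iff_lt.1 hr.1
    have := t.lt_iff_lt.1 hr.2
    omega
  have hsub : range γ ⊆ G.support := fun z hz => hR.support_eq ▸ Or.inr ⟨_, he, hz⟩
  let L : List G.verts := List.ofFn fun i => ⟨γ (t i), (ht i).1⟩
  have hchain : L.IsChain G.graph.Adj := List.isChain_ofFn.2 fun i hi =>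
    adj_of_forall_Ioo_notMem hγ hinj hsub (t.lt_iff_lt.2 i.lt_succ_self) _ _ (hgap _ _ rfl)
  have hnodup : L.Nodup := List.nodup_ofFn.2 fun i j h =>
    t.injective (hinj (congrArg Subtype.val h))
  calc ((G.verts \ R.verts) ∩ range γ).ncard = (γ ⁻¹' (G.verts \ R.verts)).ncard := by
        rw [← image_preimage_eq_inter_range, ncard_image_of_injective _ hinj]
    _ = L.length := by rw [List.length_ofFn, ncard_eq_toFinset_card _ hfin]
    _ ≤ G.longestTwoPath := length_le_longestTwoPath hchain hnodup fun w hw => by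
        obtain ⟨i, rfl⟩ := (List.mem_ofFn' ..).1 hw
        exact hR.degree_eq_two _ (ht i)

/-- The combinatorial data of the subdivision of the edge `g` at `w` into `e₁` and `e₂`, in a form
that is symmetric in the two parts. -/
structure Subdivides (G G' : PlaneGraph) (g : Set Plane) (w : Plane) (e₁ e₂ : Set Plane) :
    Prop where
  mem : g ∈ G.edges
  notMem : w ∉ G.verts
  nontrivial₁ : e₁.Nontrivial
  nontrivial₂ : e₂.Nontrivial
  union : e₁ ∪ e₂ = g
  inter : e₁ ∩ e₂ = {w}
  verts_eq : G'.verts = insert w G.verts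
  edges_eq : G'.edges = (G.edges \ {g}) ∪ {e₁, e₂}

theorem IsEdgeSubdivision.exists_subdivides (h : IsEdgeSubdivision G G') :
    ∃ g w e₁ e₂, Subdivides G G' g w e₁ e₂ := by
  obtain ⟨g, hg, u, -, v, -, w, hw, e₁, e₂, h₁, h₂, hunion, hinter, hverts, hedges⟩ := h
  exact ⟨g, w, e₁, e₂, hg, hw, ⟨u, h₁.left_mem, w, h₁.right_mem, h₁.ne⟩,
    ⟨w, h₂.left_mem, v, h₂.right_mem, h₂.ne⟩, hunion, hinter, hverts, hedges⟩

namespace Subdivides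

variable {g e₁ e₂ : Set Plane} {w z : Plane}

theorem symm (h : Subdivides G G' g w e₁ e₂) : Subdivides G G' g w e₂ e₁ where
  mem := h.mem
  notMem := h.notMem
  nontrivial₁ := h.nontrivial₂
  nontrivial₂ := h.nontrivial₁
  union := by rw [union_comm, h.union]
  inter := by rw [inter_comm, h.inter]
  verts_eq := h.verts_eq
  edges_eq := by rw [h.edges_eq, pair_comm]

theorem subset (h : Subdivides G G' g w e₁ e₂) : e₁ ⊆ g := h.union ▸ subset_union_left

theorem mem_inter (h : Subdivides G G' g w e₁ e₂) : w ∈ e₁ ∩ e₂ := h.inter ▸ mem_singleton w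

theorem not_subset (h : Subdivides G G' g w e₁ e₂) : ¬ e₁ ⊆ e₂ := fun hsub =>
  h.nontrivial₁.not_subset_singleton (h.inter ▸ subset_inter Subset.rfl hsub)

theorem notMem_edge_of_ne (h : Subdivides G G' g w e₁ e₂) (he : e ∈ G.edges) (hne : e ≠ g) :
    w ∉ e := fun hw => h.notMem (G.inter_subset e he g h.mem hne ⟨hw, h.subset h.mem_inter.1⟩)

theorem notMem_edges (h : Subdivides G G' g w e₁ e₂) : e₁ ∉ G.edges := fun he => by
  by_cases hne : e₁ = g
  · exact h.symm.not_subset (hne ▸ h.symm.subset)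
  · exact h.notMem_edge_of_ne he hne h.mem_inter.1

theorem support_eq (h : Subdivides G G' g w e₁ e₂) : G'.support = G.support := by
  have hedges : ⋃₀ G'.edges = ⋃₀ G.edges := by
    rw [h.edges_eq, sUnion_union, sUnion_pair, h.union, ← sUnion_singleton (s := g),
      ← sUnion_union, sUnion_singleton, sdiff_union_of_subset (singleton_subset_iff.2 h.mem)]
  rw [support, support, hedges, h.verts_eq, insert_union, insert_eq_of_mem]
  exact Or.inr ⟨g, h.mem, h.subset h.mem_inter.1⟩

theorem degree_new (h : Subdivides G G' g w e₁ e₂) : G'.degree w = 2 := by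
  have hedges : {e ∈ G'.edges | w ∈ e} = {e₁, e₂} := by
    rw [h.edges_eq]
    refine Subset.antisymm ?_ ?_
    · rintro e ⟨he | he, hw⟩
      · exact absurd hw (h.notMem_edge_of_ne he.1 he.2)
      · exact he
    · rintro e (rfl | rfl)
      · exact ⟨Or.inr (Or.inl rfl), h.mem_inter.1⟩
      · exact ⟨Or.inr (Or.inr rfl), h.mem_inter.2⟩
  rw [degree, hedges, ncard_pair fun heq => h.not_subset heq.subset]

theorem degree_eq_of_mem (h : Subdivides G G' g w e₁ e₂) (hz : z ∈ e₁) (hz₂ : z ∉ e₂) :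
    G'.degree z = G.degree z := by
  have hedges : {e ∈ G'.edges | z ∈ e} = insert e₁ ({e ∈ G.edges | z ∈ e} \ {g}) := by
    rw [h.edges_eq]
    ext e
    constructor
    · rintro ⟨he | rfl | rfl, hze⟩
      · exact Or.inr ⟨⟨he.1, hze⟩, he.2⟩
      · exact Or.inl rfl
      · exact absurd hze hz₂
    · rintro (rfl | he)
      · exact ⟨Or.inr (Or.inl rfl), hz⟩
      · exact ⟨Or.inl ⟨he.1.1, he.2⟩, he.1.2⟩
  rw [degree, hedges, degree]
  exact ncard_exchange (fun he => h.notMem_edges he.1) ⟨h.mem, h.subset hz⟩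

theorem degree_eq (h : Subdivides G G' g w e₁ e₂) (hz : z ∈ G.verts) :
    G'.degree z = G.degree z := by
  have hzw : ¬ (z ∈ e₁ ∧ z ∈ e₂) := fun hz' =>
    h.notMem ((h.inter ▸ hz' : z ∈ ({w} : Set Plane)) ▸ hz)
  by_cases hz₁ : z ∈ e₁
  · exact h.degree_eq_of_mem hz₁ fun hz₂ => hzw ⟨hz₁, hz₂⟩
  by_cases hz₂ : z ∈ e₂
  · exact h.symm.degree_eq_of_mem hz₂ hz₁
  have hzg : z ∉ g := h.union ▸ fun hz' => hz'.elim hz₁ hz₂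
  rw [degree, degree, h.edges_eq]
  congr 1
  ext e
  constructor
  · rintro ⟨he | rfl | rfl, hze⟩
    · exact ⟨he.1, hze⟩
    · exact absurd hze hz₁
    · exact absurd hze hz₂
  · rintro ⟨he, hze⟩
    exact ⟨Or.inl ⟨he, fun heq => hzg (heq ▸ hze)⟩, hze⟩

end Subdivides

theorem Refines.of_subdivides (hR : Refines R G) {g e₁ e₂ : Set Plane} {w : Plane}
    (h : Subdivides G G' g w e₁ e₂) : Refines R G' where
  support_eq := h.support_eq.trans hR.support_eq
  verts_subset := hR.verts_subset.trans (h.verts_eq ▸ subset_insert _ _)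
  degree_eq_two := by
    rintro z ⟨hz, hzR⟩
    rw [h.verts_eq] at hz
    rcases hz with rfl | hz
    · exact h.degree_new
    · exact (h.degree_eq hz).trans (hR.degree_eq_two z ⟨hz, hzR⟩)

theorem IsSubdivision.refines (h : IsSubdivision R G) : Refines R G := by
  induction h with
  | refl => exact ⟨rfl, Subset.rfl, fun z hz => absurd hz.1 hz.2⟩
  | tail _ h ih =>
    obtain ⟨g, w, e₁, e₂, hs⟩ := h.exists_subdivides
    exact ih.of_subdivides hs

theorem Refines.faces_eq (hR : Refines R G) : G.faces = R.faces := by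
  rw [faces, faces, hR.support_eq]

theorem Refines.one_le_longestTwoPath (hR : Refines R G) {z : Plane}
    (hz : z ∈ G.verts \ R.verts) : 1 ≤ G.longestTwoPath := by
  obtain ⟨e, he, hze⟩ := hR.exists_edge_mem hz
  refine le_trans ?_ (hR.ncard_inter_le_longestTwoPath he)
  exact (ncard_pos (G.finite_verts.sdiff.inter_of_left e)).2 ⟨z, hz, hze⟩

theorem faceDegree_le_maxFaceDegree {f : Set Plane} (hf : f ∈ G.faces) :
    G.faceDegree f ≤ G.maxFaceDegree := by
  refine le_csSup ⟨G.verts.ncard, ?_⟩ ⟨f, hf, rfl⟩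
  rintro n ⟨f, -, rfl⟩
  exact ncard_le_ncard inter_subset_left G.finite_verts

theorem Refines.ncard_inter_frontier_add_three_le (hR : Refines R G) (hsimple : R.IsSimple)
    (h3 : 3 ≤ R.verts.ncard) {f : Set Plane} (hf : f ∈ R.faces) :
    ((G.verts \ R.verts) ∩ frontier f).ncard + 3 ≤ G.maxFaceDegree := calc
  ((G.verts \ R.verts) ∩ frontier f).ncard + 3
      ≤ ((G.verts \ R.verts) ∩ frontier f).ncard + (R.verts ∩ frontier f).ncard :=
    Nat.add_le_add_left (hsimple.three_le_faceDegree h3 hf) _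
  _ = (G.verts ∩ frontier f).ncard := by
    rw [← ncard_union_eq (disjoint_sdiff_left.mono inter_subset_left inter_subset_left)
      (G.finite_verts.sdiff.inter_of_left _) (R.finite_verts.inter_of_left _),
      ← union_inter_distrib_right, sdiff_union_of_subset hR.verts_subset]
  _ ≤ G.maxFaceDegree := faceDegree_le_maxFaceDegree (hR.faces_eq ▸ hf)

theorem exists_isCyclicColoring :
    ∃ c : G.verts → Fin G.cyclicChromaticNumber, G.IsCyclicColoring c := by
  have := G.finite_verts.fintype
  exact Nat.sInf_mem (s := {k : ℕ | ∃ c : G.verts → Fin k, G.IsCyclicColoring c})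
    ⟨Fintype.card G.verts, Fintype.equivFin G.verts,
      fun _ _ u v _ _ huv h => huv ((Fintype.equivFin G.verts).injective h)⟩

theorem Refines.ncard_inter_frontier_inter_frontier_le (hR : Refines R G)
    (hconn : R.IsThreeConnected) {f f' : Set Plane} (hf : f ∈ R.faces) (hf' : f' ∈ R.faces)
    (hff' : f ≠ f') :
    ((G.verts \ R.verts) ∩ (frontier f ∩ frontier f')).ncard ≤ G.longestTwoPath := by
  rcases ((G.verts \ R.verts) ∩ (frontier f ∩ frontier f')).eq_empty_or_nonempty with
    hempty | ⟨z, hz, hzf, hzf'⟩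
  · simp [hempty]
  obtain ⟨e, he, hze⟩ := hR.exists_edge_mem hz
  refine (ncard_le_ncard ?_ (G.finite_verts.sdiff.inter_of_left e)).trans
    (hR.ncard_inter_le_longestTwoPath he)
  rintro y ⟨hy, hyf, hyf'⟩
  obtain ⟨e', he', hye'⟩ := hR.exists_edge_mem hy
  obtain rfl := hconn.edge_eq_of_mem_frontier he he' hf hf' hff' ⟨hze, hz.2⟩ ⟨hye', hy.2⟩
    hzf hzf' hyf hyf'
  exact ⟨hy, hye'⟩

theorem Refines.exists_coloring_sdiff (hR : Refines R G) (hsimple : R.IsSimple)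
    (hconn : R.IsThreeConnected) :
    ∃ c : ↥(G.verts \ R.verts) → Fin (G.maxFaceDegree - 3 + G.longestTwoPath),
      ∀ f ∈ R.faces, InjOn c {z | (z : Plane) ∈ frontier f} := by
  rcases isEmpty_or_nonempty ↥(G.verts \ R.verts) with hW | ⟨⟨z⟩⟩
  · exact ⟨isEmptyElim, fun f _ z => isEmptyElim z⟩
  have := (G.finite_verts.sdiff (t := R.verts)).to_subtype
  have hncard : ∀ s : Set Plane, {z : ↥(G.verts \ R.verts) | (z : Plane) ∈ s}.ncard =
      ((G.verts \ R.verts) ∩ s).ncard := fun s => by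
    rw [← Subtype.image_preimage_coe, ncard_image_of_injective _ Subtype.val_injective]
    rfl
  let M : R.faces → Set ↥(G.verts \ R.verts) := fun f => {z | (z : Plane) ∈ frontier f.1}
  have hle_two : ∀ z, {f | z ∈ M f}.encard ≤ 2 := fun z => by
    obtain ⟨e, he, hze⟩ := hR.exists_edge_mem z.2
    rw [← Subtype.val_injective.encard_image]
    refine (encard_le_encard ?_).trans (R.encard_faces_le_two he ⟨hze, z.2.2⟩)
    rintro _ ⟨f, hf, rfl⟩
    exact ⟨f.2, hf⟩
  have hcard : ∀ f, (M f).ncard ≤ G.maxFaceDegree - 3 := fun f =>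
    (hncard _).trans_le <| Nat.le_sub_of_add_le <|
      hR.ncard_inter_frontier_add_three_le hsimple (Nat.le_of_succ_le hconn.1) f.2
  have hinter : ∀ f f', f ≠ f' → (M f ∩ M f').ncard ≤ G.longestTwoPath := fun f f' hff' =>
    (hncard _).trans_le <|
      hR.ncard_inter_frontier_inter_frontier_le hconn f.2 f'.2 (Subtype.coe_ne_coe.2 hff')
  obtain ⟨c, hc⟩ := exists_coloring_injOn_blocks (hR.one_le_longestTwoPath z.2)
    hle_two hcard hinter
  exact ⟨c, fun f hf => hc ⟨f, hf⟩⟩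

theorem Refines.cyclicChromaticNumber_le (hR : Refines R G) (hsimple : R.IsSimple)
    (hconn : R.IsThreeConnected) : G.cyclicChromaticNumber ≤
      R.cyclicChromaticNumber + (G.maxFaceDegree - 3 + G.longestTwoPath) := by
  classical
  obtain ⟨c₁, hc₁⟩ := R.exists_isCyclicColoring
  obtain ⟨c₂, hc₂⟩ := hR.exists_coloring_sdiff hsimple hconn
  refine Nat.sInf_le ⟨fun z => finSumFinEquiv (if h : (z : Plane) ∈ R.verts then
    .inl (c₁ ⟨z, h⟩) else .inr (c₂ ⟨z, z.2, h⟩)), fun f hf u v hu hv huv h => ?_⟩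
  rw [hR.faces_eq] at hf
  replace h := finSumFinEquiv.injective h
  by_cases hu' : (u : Plane) ∈ R.verts <;> by_cases hv' : (v : Plane) ∈ R.verts
  · simp only [hu', hv', dite_true, Sum.inl.injEq] at h
    exact hc₁ f hf ⟨u, hu'⟩ ⟨v, hv'⟩ ⟨hu', hu.2⟩ ⟨hv', hv.2⟩
      (fun heq => huv (Subtype.ext (Subtype.mk.inj heq))) h
  · simp [hu', hv'] at h
  · simp [hu', hv'] at h
  · simp only [hu', hv', dite_false, Sum.inr.injEq] at h
    exact huv (Subtype.ext (Subtype.mk.inj (hc₂ f hf hu.2 hv.2 h)))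

end PlaneGraph

/-- Here `3 * G.maxFaceDegree / 2` is division of natural numbers, rounded down. -/
theorem corollary2 (R G : PlaneGraph) (hsimple : R.IsSimple) (hconn : R.IsThreeConnected)
    (hsub : R.IsSubdivision G)
    (hdeg : (G.maxFaceDegree : ℤ) ≥
      2 * (R.cyclicChromaticNumber : ℤ) + 2 * (G.longestTwoPath : ℤ) - 6) :
    G.cyclicChromaticNumber ≤ 3 * G.maxFaceDegree / 2 := by
  have hR : R.Refines G := hsub.refines
  have hdegree : 3 ≤ G.maxFaceDegree := by
    obtain ⟨f, hf⟩ := R.exists_face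
    exact le_of_add_le_right
      (hR.ncard_inter_frontier_add_three_le hsimple (Nat.le_of_succ_le hconn.1) hf)
  have hχ : G.cyclicChromaticNumber ≤
      R.cyclicChromaticNumber + (G.maxFaceDegree - 3 + G.longestTwoPath) :=
    hR.cyclicChromaticNumber_le hsimple hconn
  omega
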